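/- Let $\mathbb K$ be an algebraically closed field and let $S=\mathbb K[x_0,\dots,x_n]$ with its standard grading and irrelevant ideal $S_+$. Let $f_0,\dots,f_n\in S$ be homogeneous polynomials (of degrees $d_0,\dots,d_n$) such that $f_1,\dots,f_n$ is a regular sequence, and put $I=(f_0,\dots,f_n)$, $J=(f_1,\dots,f_n)$ and $T=S/J$. Assume that $\dim\operatorname{Proj}(S/I)=0$. Let $I^s=\bigcup_{i}(I:S_+^i)$ be the saturation of $I$, let $H$ be the image of $I^s$ in $T$, and set $K=(0:_T H)$, $A=T/H$, $B=T/K$. Then there are isomorphisms of graded $T$-modules (preserving degrees) $$K\cong\operatorname{Hom}_T(A,T),\qquad H\cong\operatorname{Hom}_T(B,T),$$ and $A$ is a Cohen–Macaulay ring of dimension one. If moreover $I\neq J$, then $B$ is a Cohen–Macaulay ring of dimension one, and $A$ and $B$ are algebraically linked by the complete intersection $T$. The latter means: $T$ is a complete intersection graded ring (isomorphic, as a graded $\mathbb K$-algebra, to a quotient of a polynomial ring over $\mathbb K$ by a regular sequence of homogeneous polynomials), $H$ and $K$ are homogeneous ideals of $T$ of height $0$, each of the rings $A$ and $B$ is equidimensional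 (all its minimal primes have quotients of the same dimension as the ring) and without embedded components (all its associated primes are minimal), and there are isomorphisms of graded $T$-modules $H\cong\operatorname{Hom}_T(B,T)$ and $K\cong\operatorname{Hom}_T(A,T)$. -/

import Mathlib

attribute [local instance] MvPolynomial.gradedAlgebra

noncomputable section

namespace GradedLinkage

open DirectSum

section QuotientGrading

variable {𝕜 S : Type*} [Field 𝕜] [CommRing S] [Algebra 𝕜 S]

/-- The degree `i` part of `S ⧸ I` is the image of the degree `i` part of `S`. -/
def quotientGrading (𝒜 : ℕ → Submodule 𝕜 S) (I : Ideal S) : ℕ → Submodule 𝕜 (S ⧸ I) :=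
  fun i => (𝒜 i).map (Ideal.Quotient.mkₐ 𝕜 I).toLinearMap

variable (𝒜 : ℕ → Submodule 𝕜 S)

theorem mk_mem_quotientGrading (I : Ideal S) {i : ℕ} {x : S} (hx : x ∈ 𝒜 i) :
    Ideal.Quotient.mk I x ∈ quotientGrading 𝒜 I i :=
  ⟨x, hx, rfl⟩

/-- The map from the degree `i` part of `S` to the degree `i` part of `S ⧸ I`. -/
def toQuotientGrading (I : Ideal S) (i : ℕ) : 𝒜 i →+ quotientGrading 𝒜 I i where
  toFun x := ⟨Ideal.Quotient.mk I x, mk_mem_quotientGrading 𝒜 I x.2⟩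
  map_zero' := Subtype.ext (by simp)
  map_add' x y := Subtype.ext (by simp)

variable [GradedAlgebra 𝒜]

/-- The decomposition of an element of `S ⧸ I` into its homogeneous components. -/
def quotientDecompose (I : HomogeneousIdeal 𝒜) :
    (S ⧸ I.toIdeal) →+ ⨁ i, quotientGrading 𝒜 I.toIdeal i :=
  QuotientAddGroup.lift I.toIdeal.toAddSubgroup
    ((DirectSum.map (toQuotientGrading 𝒜 I.toIdeal)).comp
      (decomposeAddEquiv 𝒜).toAddMonoidHom) (by
    intro x hx
    refine DFinsupp.ext fun i => Subtype.ext ?_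
    have h : ((decompose 𝒜 x i : 𝒜 i) : S) ∈ I.toIdeal := I.isHomogeneous i hx
    simpa [DirectSum.map_apply, toQuotientGrading] using Ideal.Quotient.eq_zero_iff_mem.2 h)

/-- The quotient of a graded algebra by a homogeneous ideal is a graded algebra. -/
instance quotientGradedAlgebra (I : HomogeneousIdeal 𝒜) :
    GradedAlgebra (quotientGrading 𝒜 I.toIdeal) where
  one_mem := ⟨1, SetLike.one_mem_graded 𝒜, rfl⟩
  mul_mem := by
    rintro i j _ _ ⟨x, hx, rfl⟩ ⟨y, hy, rfl⟩
    exact ⟨x * y, SetLike.mul_mem_graded hx hy, by simp⟩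
  toDecomposition := Decomposition.ofAddHom _ (quotientDecompose 𝒜 I)
    (by
      ext x
      obtain ⟨x, rfl⟩ := Ideal.Quotient.mk_surjective x
      induction x using Decomposition.inductionOn 𝒜 with
      | zero => simp
      | @homogeneous i m =>
        have : quotientDecompose 𝒜 I (Ideal.Quotient.mk I.toIdeal (m : S)) =
            DirectSum.of (fun i => quotientGrading 𝒜 I.toIdeal i) i
              (toQuotientGrading 𝒜 I.toIdeal i m) := by
          change (DirectSum.map (toQuotientGrading 𝒜 I.toIdeal)) (decompose 𝒜 (m : S)) = _
          rw [decompose_coe, DirectSum.map_of]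
        simp only [AddMonoidHom.comp_apply, this, DirectSum.coeAddMonoidHom_of]
        rfl
      | add a b ha hb => simp only [map_add, ha, hb])
    (by
      ext i ⟨_, m, hm, rfl⟩ : 2
      change (quotientDecompose 𝒜 I) (DirectSum.coeAddMonoidHom _ (DirectSum.of _ i _)) = DirectSum.of _ i _
      rw [DirectSum.coeAddMonoidHom_of]
      change (DirectSum.map (toQuotientGrading 𝒜 I.toIdeal)) (decompose 𝒜 (m : S)) = _
      rw [decompose_of_mem 𝒜 hm, DirectSum.map_of]
      rfl)

/-- The saturation `⋃ᵢ (I : (S₊)ⁱ)` of `I`; the union is increasing, so it is the supremum. -/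
def saturation (I : Ideal S) : Ideal S :=
  ⨆ i : ℕ, I.colon (((HomogeneousIdeal.irrelevant 𝒜).toIdeal ^ i : Ideal S) : Set S)

end QuotientGrading

section GradedHom

variable {𝕜 T M N : Type*} [Field 𝕜] [CommRing T] [Algebra 𝕜 T]
  [AddCommGroup M] [Module T M] [Module 𝕜 M] [IsScalarTower 𝕜 T M]
  [AddCommGroup N] [Module T N] [Module 𝕜 N] [IsScalarTower 𝕜 T N]

/-- A grading by `ℕ`, regarded as a grading by `ℤ` that vanishes in negative degrees. -/
def intGrading (𝒩 : ℕ → Submodule 𝕜 N) (d : ℤ) : Submodule 𝕜 N :=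
  if 0 ≤ d then 𝒩 d.toNat else ⊥

/-- `φ : M → N` is homogeneous of degree `d`: it maps `Mᵢ` to `N_{i + d}` for all `i`.
These maps form the degree `d` part of the graded module `Hom_T(M, N)`. -/
def IsHomOfDegree (ℳ : ℕ → Submodule 𝕜 M) (𝒩 : ℕ → Submodule 𝕜 N) (d : ℤ)
    (φ : M →ₗ[T] N) : Prop :=
  ∀ (i : ℕ), ∀ x ∈ ℳ i, φ x ∈ intGrading 𝒩 (i + d)

/-- For ideals `H` and `K` of a graded ring `T`: there is an isomorphism of graded `T`-modules
`H ≅ Hom_T(T ⧸ K, T)`, that is, a `T`-linear bijection under which the elements of degree `d`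
correspond to each other for all `d : ℤ`. -/
def GradedIsoHomQuotient (𝒯 : ℕ → Submodule 𝕜 T) (H K : Ideal T) : Prop :=
  ∃ e : H ≃ₗ[T] ((T ⧸ K) →ₗ[T] T), ∀ (d : ℤ) (x : H),
    (x : T) ∈ intGrading 𝒯 d ↔ IsHomOfDegree (quotientGrading 𝒯 K) 𝒯 d (e x)

end GradedHom

section RingProperties

/-- All irreducible components of `Spec Q` have the same dimension. -/
def IsEquidimensional (Q : Type*) [CommRing Q] : Prop :=
  ∀ P ∈ minimalPrimes Q, ringKrullDim (Q ⧸ P) = ringKrullDim Q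

/-- `Q` has no embedded components: all its associated primes are minimal. -/
def HasNoEmbeddedComponents (Q : Type*) [CommRing Q] : Prop :=
  ∀ P ∈ associatedPrimes Q Q, P ∈ minimalPrimes Q

/-- A Noetherian local ring is Cohen–Macaulay if its maximal ideal contains a regular sequence
whose length is the dimension of the ring. -/
def IsCohenMacaulayLocalRing (Q : Type*) [CommRing Q] [IsLocalRing Q] : Prop :=
  IsNoetherianRing Q ∧ ∃ rs : List Q, (∀ r ∈ rs, r ∈ IsLocalRing.maximalIdeal Q) ∧
    RingTheory.Sequence.IsRegular Q rs ∧ (rs.length : WithBot ℕ∞) = ringKrullDim Q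

/-- A Noetherian ring is Cohen–Macaulay if its localizations at maximal ideals are. -/
def IsCohenMacaulayRing (Q : Type*) [CommRing Q] : Prop :=
  IsNoetherianRing Q ∧
    ∀ (m : Ideal Q) [m.IsMaximal], IsCohenMacaulayLocalRing (Localization.AtPrime m)

end RingProperties

section Linkage

variable {𝕜 T : Type*} [Field 𝕜] [CommRing T] [Algebra 𝕜 T]

/-- `T` is a complete intersection graded ring: as a graded `𝕜`-algebra it is isomorphic to the
quotient of a polynomial ring by a regular sequence of homogeneous polynomials. -/
def IsCompleteIntersection (𝒯 : ℕ → Submodule 𝕜 T) : Prop :=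
  ∃ (n m : ℕ) (g : Fin m → MvPolynomial (Fin n) 𝕜) (d : Fin m → ℕ),
    (∀ i, (g i).IsHomogeneous (d i)) ∧
    RingTheory.Sequence.IsRegular (MvPolynomial (Fin n) 𝕜) (List.ofFn g) ∧
    ∃ e : (MvPolynomial (Fin n) 𝕜 ⧸ Ideal.span (Set.range g)) ≃ₐ[𝕜] T, ∀ i x,
      x ∈ quotientGrading (MvPolynomial.homogeneousSubmodule (Fin n) 𝕜)
        (Ideal.span (Set.range g)) i ↔ e x ∈ 𝒯 i

/-- `T ⧸ H` and `T ⧸ K` are algebraically linked by the complete intersection `T`. -/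
structure AlgebraicallyLinked (𝒯 : ℕ → Submodule 𝕜 T) [GradedAlgebra 𝒯] (H K : Ideal T) :
    Prop where
  completeIntersection : IsCompleteIntersection 𝒯
  homogeneous_left : H.IsHomogeneous 𝒯
  homogeneous_right : K.IsHomogeneous 𝒯
  height_left : H.height = 0
  height_right : K.height = 0
  equidimensional_left : IsEquidimensional (T ⧸ H)
  equidimensional_right : IsEquidimensional (T ⧸ K)
  noEmbedded_left : HasNoEmbeddedComponents (T ⧸ H)
  noEmbedded_right : HasNoEmbeddedComponents (T ⧸ K)
  iso_left : GradedIsoHomQuotient 𝒯 H K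
  iso_right : GradedIsoHomQuotient 𝒯 K H

end Linkage

end GradedLinkage

end

/-! `T` is a graded complete intersection of dimension at most one, hence Gorenstein, and linkage is
duality over it. The isomorphism `K ≅ Hom(A, T)` is evaluation at `1`
(`gradedIsoHomQuotient_of_eq_colon`). The same argument gives `H ≅ Hom(B, T)` once `H = 0 : K`, so
the real content is this double annihilator property.

It is proved in the localization `R` at `S₊` (`colon_colon_le_of_regular`). Choose `l` in the
maximal ideal regular on both `R/J` and `R/h`, where `h` is the localized saturation. For `N > 0`
the ring `R/(J, l^N)` is Artinian with socle of rank at most one: the socle rank modulo a regular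
sequence depends only on its length (`SocleRankLE.exchange_list`, an elementary substitute for
`Ext(k, R)`), and modulo the variables the ring is the residue field. A length count gives double
annihilators there (`annihilator_annihilator_le`); Artin–Rees and Krull's intersection theorem then
let `N` grow (`colon_colon_le_of_regularModulo`). The localization is undone because elements
outside `S₊` are nonzerodivisors modulo any homogeneous ideal.

The other claims are about depth. The irrelevant ideal is associated neither to `T/H`, by
saturation, nor to `T`, by exchange with the variables, hence not to `T/K` either. Associated primes
of homogeneous ideals are homogeneous and so lie in the irrelevant ideal; thus none of them is
maximal. In dimension at most one this yields Cohen–Macaulayness, equidimensionality, absence of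
embedded components and height zero. A point of Proj makes `A` nonzero, and `I ≠ J` makes `B`
nonzero. -/

namespace GradedLinkage

open IsLocalRing

/-! ### Regular elements and sequences modulo an ideal -/

section RegularModulo

variable {R : Type*} [CommRing R]

/-- Multiplication by `x` is injective on `R ⧸ I`. -/
def RegularModulo (I : Ideal R) (x : R) : Prop :=
  ∀ a, x * a ∈ I → a ∈ I

/-- The sequence is weakly regular on `R ⧸ I`. -/
def RegularSeqModulo : Ideal R → List R → Prop
  | _, [] => True
  | I, x :: xs => RegularModulo I x ∧ RegularSeqModulo (I ⊔ Ideal.span {x}) xs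

theorem RegularModulo.pow {I : Ideal R} {x : R} (h : RegularModulo I x) (n : ℕ) :
    RegularModulo I (x ^ n) := by
  induction n with
  | zero => intro a ha; simpa using ha
  | succ n ih =>
    intro a ha
    rw [pow_succ, mul_assoc] at ha
    exact h a (ih _ ha)

theorem regularModulo_iff_isSMulRegular {I : Ideal R} {x : R} :
    RegularModulo I x ↔ IsSMulRegular (R ⧸ I) x := by
  rw [isSMulRegular_iff_right_eq_zero_of_smul]
  constructor
  · intro h b hb
    obtain ⟨a, rfl⟩ := Ideal.Quotient.mk_surjective b
    exact Ideal.Quotient.eq_zero_iff_mem.2 (h a (Ideal.Quotient.eq_zero_iff_mem.1 hb))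
  · intro h a ha
    exact Ideal.Quotient.eq_zero_iff_mem.1
      (h (Ideal.Quotient.mk I a) (Ideal.Quotient.eq_zero_iff_mem.2 ha))

theorem regularSeqModulo_append {I : Ideal R} {xs ys : List R} :
    RegularSeqModulo I (xs ++ ys) ↔
      RegularSeqModulo I xs ∧ RegularSeqModulo (I ⊔ Ideal.ofList xs) ys := by
  induction xs generalizing I with
  | nil => simp [RegularSeqModulo]
  | cons x xs ih => simp [RegularSeqModulo, ih, and_assoc, sup_assoc]

theorem regularSeqModulo_singleton {I : Ideal R} {x : R} :
    RegularSeqModulo I [x] ↔ RegularModulo I x := by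
  simp [RegularSeqModulo]

theorem regularSeqModulo_of_forall {I : Ideal R} {xs : List R}
    (h : ∀ (i : ℕ) (hi : i < xs.length), RegularModulo (I ⊔ Ideal.ofList (xs.take i)) xs[i]) :
    RegularSeqModulo I xs := by
  induction xs generalizing I with
  | nil => trivial
  | cons x xs ih =>
    have h0 := h 0 (by simp)
    rw [List.take_zero, Ideal.ofList_nil, sup_bot_eq] at h0
    refine ⟨h0, ih fun i hi => ?_⟩
    have h1 := h (i + 1) (by simpa using hi)
    rw [List.take_succ_cons, Ideal.ofList_cons, ← sup_assoc] at h1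
    exact h1

theorem RegularSeqModulo.of_isWeaklyRegular {xs : List R}
    (h : RingTheory.Sequence.IsWeaklyRegular R xs) : RegularSeqModulo ⊥ xs := by
  refine regularSeqModulo_of_forall fun i hi => ?_
  have := h.regular_mod_prev i hi
  rw [smul_eq_mul, Ideal.mul_top] at this
  rw [bot_sup_eq]
  exact regularModulo_iff_isSMulRegular.2 this

/-- Prime avoidance: a common nonzerodivisor for two cyclic modules. -/
theorem exists_mem_regularModulo [IsNoetherianRing R] {m I₁ I₂ : Ideal R} {x₁ x₂ : R}
    (hx₁ : x₁ ∈ m) (h₁ : RegularModulo I₁ x₁) (hx₂ : x₂ ∈ m) (h₂ : RegularModulo I₂ x₂) :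
    ∃ z ∈ m, RegularModulo I₁ z ∧ RegularModulo I₂ z := by
  by_contra! hcon
  have hU : ∀ I : Ideal R, ⋃ p ∈ associatedPrimes R (R ⧸ I), (p : Set R) =
      {r : R | RegularModulo I r}ᶜ := by
    intro I
    rw [biUnion_associatedPrimes_eq_compl_regular]
    simp_rw [regularModulo_iff_isSMulRegular]
  have hsub : (m : Set R) ⊆ ⋃ p ∈ associatedPrimes R (R ⧸ I₁) ∪ associatedPrimes R (R ⧸ I₂),
      ((id p : Ideal R) : Set R) := by
    intro z hz
    rw [Set.biUnion_union]
    simp only [id]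
    rw [hU, hU]
    by_cases h : RegularModulo I₁ z
    · exact Or.inr (hcon z hz h)
    · exact Or.inl h
  obtain ⟨P, hP, hle⟩ := (Ideal.subset_union_prime_finite
    ((associatedPrimes.finite R (R ⧸ I₁)).union (associatedPrimes.finite R (R ⧸ I₂)))
    (f := id) ⊥ ⊥ (by rintro P (hP | hP) _ _ <;> exact hP.isPrime)).1 hsub
  rcases hP with hP | hP
  · have : x₁ ∈ ⋃ p ∈ associatedPrimes R (R ⧸ I₁), (p : Set R) :=
      Set.mem_biUnion hP (hle hx₁)
    rw [hU] at this
    exact this h₁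
  · have : x₂ ∈ ⋃ p ∈ associatedPrimes R (R ⧸ I₂), (p : Set R) :=
      Set.mem_biUnion hP (hle hx₂)
    rw [hU] at this
    exact this h₂

/-- Each nonzerodivisor lowers the dimension by at least one. This inequality serves both to bound
`dim T` and to make the quotients by full-length sequences Artinian. -/
theorem ringKrullDim_quotient_sup_add_length_le {I : Ideal R} {xs : List R}
    (h : RegularSeqModulo I xs) :
    ringKrullDim (R ⧸ (I ⊔ Ideal.ofList xs)) + xs.length ≤ ringKrullDim (R ⧸ I) := by
  induction xs generalizing I with
  | nil => rw [Ideal.ofList_nil, sup_bot_eq]; simp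
  | cons x xs ih =>
    have h1 := ih h.2
    rw [sup_assoc, ← Ideal.ofList_cons] at h1
    have hx : Ideal.Quotient.mk I x ∈ nonZeroDivisors (R ⧸ I) := by
      rw [mem_nonZeroDivisors_iff_right]
      intro b hb
      obtain ⟨a, rfl⟩ := Ideal.Quotient.mk_surjective b
      rw [← map_mul, mul_comm, Ideal.Quotient.eq_zero_iff_mem] at hb
      exact Ideal.Quotient.eq_zero_iff_mem.2 (h.1 a hb)
    have h2 := ringKrullDim_quotient_succ_le_of_nonZeroDivisor hx
    have h3 : ringKrullDim ((R ⧸ I) ⧸ Ideal.span {Ideal.Quotient.mk I x}) =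
        ringKrullDim (R ⧸ (I ⊔ Ideal.span {x})) := by
      rw [← ringKrullDim_eq_of_ringEquiv (DoubleQuot.quotQuotEquivQuotSup I (Ideal.span {x})),
        Ideal.map_span, Set.image_singleton]
    rw [h3] at h2
    calc _ = ringKrullDim (R ⧸ (I ⊔ Ideal.ofList (x :: xs))) + xs.length + 1 := by
          simp [add_assoc]
      _ ≤ ringKrullDim (R ⧸ (I ⊔ Ideal.span {x})) + 1 := by gcongr
      _ ≤ _ := h2

/-- In a local ring the last term of a regular sequence can be moved to the front. -/
theorem RegularSeqModulo.cons_of_concat [IsNoetherianRing R] [IsLocalRing R] {I : Ideal R}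
    {xs : List R} {z : R} (hxs : ∀ x ∈ xs, x ∈ maximalIdeal R)
    (h : RegularSeqModulo I (xs ++ [z])) : RegularSeqModulo I (z :: xs) := by
  induction xs generalizing I with
  | nil => exact h
  | cons x xs ih =>
    obtain ⟨hx, h⟩ := h
    obtain ⟨hz, h⟩ := ih (fun y hy => hxs y (List.mem_cons_of_mem _ hy)) h
    have hxm : x ∈ maximalIdeal R := hxs x List.mem_cons_self
    refine ⟨?_, ?_, by rwa [sup_right_comm]⟩
    -- Nakayama: if `z * a ∈ I`, regularity of `z` modulo `(I, x)` gives `a ≡ b * x` modulo `I`, and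
    -- cancelling `x` puts `b` back in `I : z`.
    · have key : I.colon ({z} : Set R) ≤ I ⊔ maximalIdeal R • I.colon ({z} : Set R) := by
        intro a ha
        have hza : z * a ∈ I := by
          simpa [Submodule.mem_colon_singleton, mul_comm] using ha
        obtain ⟨i, hi, c, hc, hic⟩ := Submodule.mem_sup.1 (hz a (Ideal.mem_sup_left hza))
        obtain ⟨b, rfl⟩ := Ideal.mem_span_singleton'.1 hc
        refine Submodule.mem_sup.2 ⟨i, hi, b * x, ?_, hic⟩
        rw [mul_comm b x]
        refine Submodule.smul_mem_smul hxm ?_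
        rw [Submodule.mem_colon_singleton, smul_eq_mul, mul_comm]
        refine hx _ ?_
        have : x * (z * b) = z * a - z * i := by rw [← hic]; ring
        rw [this]
        exact sub_mem hza (I.mul_mem_left _ hi)
      have := Submodule.le_of_le_smul_of_le_jacobson_bot (IsNoetherian.noetherian _)
        (maximalIdeal_le_jacobson ⊥) key
      intro a ha
      refine this ?_
      simpa [Submodule.mem_colon_singleton, mul_comm] using ha
    · intro a ha
      obtain ⟨i, hi, c, hc, hic⟩ := Submodule.mem_sup.1 ha
      obtain ⟨b, rfl⟩ := Ideal.mem_span_singleton'.1 hc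
      have hb : z * b ∈ I ⊔ Ideal.span {x} := by
        have : z * b = x * a - i := by rw [← hic]; ring
        rw [this]
        exact sub_mem (Ideal.mem_sup_right (Ideal.mul_mem_right _ _ (Ideal.mem_span_singleton_self x)))
          (Ideal.mem_sup_left hi)
      obtain ⟨j, hj, e, he, hje⟩ := Submodule.mem_sup.1 (hz b hb)
      obtain ⟨c, rfl⟩ := Ideal.mem_span_singleton'.1 he
      have : a - c * z ∈ I := by
        refine hx _ ?_
        have : x * (a - c * z) = i + z * j := by
          have : x * a = i + (j + c * x) * z := by rw [hje, hic]
          linear_combination this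
        rw [this]
        exact add_mem hi (I.mul_mem_left _ hj)
      exact Submodule.mem_sup.2 ⟨_, this, c * z,
        Ideal.mul_mem_left _ _ (Ideal.mem_span_singleton_self z), by ring⟩

end RegularModulo

/-! ### Socles modulo regular sequences -/

section Socle

variable {R : Type*} [CommRing R]

/-- The part of `R ⧸ I` killed by `m` is generated by at most `k` elements. -/
def SocleRankLE (m : Ideal R) (k : ℕ) (I : Ideal R) : Prop :=
  ∃ s : Finset R, s.card ≤ k ∧ I.colon (m : Set R) = I ⊔ Ideal.span s

theorem socleRankLE_one_self (m : Ideal R) : SocleRankLE m 1 m := by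
  refine ⟨{1}, by simp, ?_⟩
  rw [(Submodule.colon_eq_top_iff_subset (N := m) _).2 le_rfl]
  simp

/-- Rank zero is the form in which positive depth of `R ⧸ I` along `m` is carried through the proof.
-/
theorem socleRankLE_zero_iff {m I : Ideal R} :
    SocleRankLE m 0 I ↔ ∀ a, (∀ t ∈ m, t * a ∈ I) → a ∈ I := by
  constructor
  · rintro ⟨s, hs, h⟩ a ha
    obtain rfl : s = ∅ := by simpa using hs
    have : a ∈ I.colon (m : Set R) :=
      Submodule.mem_colon.2 fun t ht => by simpa [mul_comm] using ha t ht
    simpa [h] using this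
  · intro h
    refine ⟨∅, le_rfl, le_antisymm (fun a ha => ?_) (by simpa using Ideal.le_colon)⟩
    simpa using h a fun t ht => by simpa [mul_comm] using Submodule.mem_colon.1 ha t ht

/-- For `x, y ∈ m` regular modulo `I`, an element of the socle modulo `(I, x)` corresponds to one
of the socle modulo `(I, y)`. -/
theorem exists_mem_colon_sup_span {m I : Ideal R} {x y a : R} (hx : RegularModulo I x)
    (hym : y ∈ m) (ha : a ∈ (I ⊔ Ideal.span {x}).colon (m : Set R)) :
    ∃ b ∈ (I ⊔ Ideal.span {y}).colon (m : Set R), b * x - a * y ∈ I := by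
  have key : ∀ t ∈ m, ∃ c, a * t - c * x ∈ I := by
    intro t ht
    obtain ⟨i, hi, e, he, h⟩ := Submodule.mem_sup.1 (Submodule.mem_colon.1 ha t ht)
    obtain ⟨c, rfl⟩ := Ideal.mem_span_singleton'.1 he
    exact ⟨c, by rw [← smul_eq_mul a t, ← h, add_sub_cancel_right]; exact hi⟩
  obtain ⟨b, hb⟩ := key y hym
  refine ⟨b, Submodule.mem_colon.2 fun t ht => ?_, by simpa using neg_mem hb⟩
  obtain ⟨c, hc⟩ := key t ht
  have : b * t - c * y ∈ I := by
    refine hx _ ?_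
    have : x * (b * t - c * y) = (a * t - c * x) * y - (a * y - b * x) * t := by ring
    rw [this]
    exact sub_mem (I.mul_mem_right _ hc) (I.mul_mem_right _ hb)
  exact Submodule.mem_sup.2 ⟨_, this, c * y,
    Ideal.mul_mem_left _ _ (Ideal.mem_span_singleton_self y), by simp⟩

/-- The relation `b * x ≡ a * y` modulo `I` matches the socles modulo `(I, x)` and `(I, y)`; both
are `Ext¹` of `R ⧸ m` into `R ⧸ I`. Generators are carried across by it, and regularity of `x` shows
that the images still generate. -/
theorem SocleRankLE.exchange {m I : Ideal R} {k : ℕ} {x y : R} (hxm : x ∈ m) (hym : y ∈ m)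
    (hx : RegularModulo I x) (hy : RegularModulo I y)
    (h : SocleRankLE m k (I ⊔ Ideal.span {x})) : SocleRankLE m k (I ⊔ Ideal.span {y}) := by
  classical
  obtain ⟨s, hsk, hs⟩ := h
  have hsub : ∀ u ∈ s, u ∈ (I ⊔ Ideal.span {x}).colon (m : Set R) := fun u hu => by
    rw [hs]; exact Ideal.mem_sup_right (Ideal.subset_span hu)
  choose! v hv hvI using fun u hu => exists_mem_colon_sup_span hx hym (hsub u hu)
  refine ⟨s.image v, Finset.card_image_le.trans hsk, le_antisymm ?_
    (sup_le Ideal.le_colon (Ideal.span_le.2 fun w hw => ?_))⟩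
  · intro b hb
    obtain ⟨a, ha, hab⟩ := exists_mem_colon_sup_span hy hxm hb
    have claim : ∀ a ∈ Ideal.span (s : Set R), ∃ b ∈ Ideal.span (s.image v : Set R),
        b * x - a * y ∈ I := by
      intro a ha
      induction ha using Submodule.span_induction with
      | mem u hu => exact ⟨v u, Ideal.subset_span (Finset.mem_image_of_mem v hu), hvI u hu⟩
      | zero => exact ⟨0, zero_mem _, by simp⟩
      | add a a' _ _ h h' =>
        obtain ⟨b, hb, h⟩ := h
        obtain ⟨b', hb', h'⟩ := h'
        refine ⟨b + b', add_mem hb hb', ?_⟩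
        have := add_mem h h'
        ring_nf at this ⊢
        exact this
      | smul r a _ h =>
        obtain ⟨b, hb, h⟩ := h
        refine ⟨r * b, Ideal.mul_mem_left _ _ hb, ?_⟩
        have : r * b * x - r • a * y = r * (b * x - a * y) := by simp; ring
        rw [this]
        exact I.mul_mem_left _ h
    rw [hs] at ha
    obtain ⟨a₁, ha₁, a₂, ha₂, rfl⟩ := Submodule.mem_sup.1 ha
    obtain ⟨i, hi, e, he, rfl⟩ := Submodule.mem_sup.1 ha₁
    obtain ⟨c, rfl⟩ := Ideal.mem_span_singleton'.1 he
    obtain ⟨b₂, hb₂, h₂⟩ := claim a₂ ha₂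
    have : b - c * y - b₂ ∈ I := by
      refine hx _ ?_
      have : x * (b - c * y - b₂) =
          i * y - ((i + c * x + a₂) * y - b * x) - (b₂ * x - a₂ * y) := by ring
      rw [this]
      exact sub_mem (sub_mem (I.mul_mem_right _ hi) hab) h₂
    rw [show b = (b - c * y - b₂) + c * y + b₂ by ring]
    exact add_mem (Ideal.mem_sup_left (add_mem (Ideal.mem_sup_left this)
      (Ideal.mem_sup_right (Ideal.mul_mem_left _ _ (Ideal.mem_span_singleton_self y)))))
      (Ideal.mem_sup_right hb₂)
  · obtain ⟨u, hu, rfl⟩ := Finset.mem_image.1 hw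
    exact hv u hu

/-- In a Noetherian local ring the rank of the socle modulo a regular sequence depends only on the
length of the sequence. -/
theorem SocleRankLE.exchange_list [IsNoetherianRing R] [IsLocalRing R] {k : ℕ} {xs ys : List R}
    (hlen : xs.length = ys.length) {I : Ideal R} (hxm : ∀ x ∈ xs, x ∈ maximalIdeal R)
    (hym : ∀ y ∈ ys, y ∈ maximalIdeal R) (hx : RegularSeqModulo I xs)
    (hy : RegularSeqModulo I ys) (h : SocleRankLE (maximalIdeal R) k (I ⊔ Ideal.ofList xs)) :
    SocleRankLE (maximalIdeal R) k (I ⊔ Ideal.ofList ys) := by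
  induction xs using List.reverseRecOn generalizing ys I with
  | nil =>
    obtain rfl : ys = [] := List.length_eq_zero_iff.1 (by simpa using hlen.symm)
    exact h
  | append_singleton xs x ih =>
    rcases List.eq_nil_or_concat ys with rfl | ⟨ys, y, rfl⟩
    · simp at hlen
    rw [List.concat_eq_append] at *
    simp only [List.length_append, List.length_cons, List.length_nil, zero_add,
      Nat.add_right_cancel_iff] at hlen
    simp only [List.mem_append, List.mem_singleton] at hxm hym
    obtain ⟨hxs, hx⟩ := regularSeqModulo_append.1 hx
    obtain ⟨hys, hy⟩ := regularSeqModulo_append.1 hy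
    rw [regularSeqModulo_singleton] at hx hy
    -- One `z` can replace the last term of both sequences. Moved to the front, it is absorbed into
    -- the base ideal, where the induction compares the shorter sequences.
    obtain ⟨z, hzm, hzx, hzy⟩ :=
      exists_mem_regularModulo (hxm x (Or.inr rfl)) hx (hym y (Or.inr rfl)) hy
    have hxs' := RegularSeqModulo.cons_of_concat (fun x hx => hxm x (Or.inl hx))
      (regularSeqModulo_append.2 ⟨hxs, regularSeqModulo_singleton.2 hzx⟩)
    have hys' := RegularSeqModulo.cons_of_concat (fun x hx => hym x (Or.inl hx))
      (regularSeqModulo_append.2 ⟨hys, regularSeqModulo_singleton.2 hzy⟩)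
    rw [Ideal.ofList_append, Ideal.ofList_singleton, ← sup_assoc] at h ⊢
    refine SocleRankLE.exchange hzm (hym y (Or.inr rfl)) hzy hy ?_
    rw [sup_right_comm]
    refine ih hlen (fun x hx => hxm x (Or.inl hx)) (fun x hx => hym x (Or.inl hx))
      hxs'.2 hys'.2 ?_
    rw [sup_right_comm]
    exact SocleRankLE.exchange (hxm x (Or.inr rfl)) hzm hx hzx h

end Socle

end GradedLinkage

namespace GradedLinkage

open IsLocalRing

/-! ### Double annihilators in Artinian local rings with simple socle -/

section DoubleAnnihilator

variable {Q : Type*} [CommRing Q]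

/-- A cyclic module killed by the maximal ideal is a quotient of the residue field. -/
theorem length_annihilator_le_one [IsLocalRing Q] {u : Q}
    (hu : (⊥ : Ideal Q).colon (maximalIdeal Q : Set Q) = Ideal.span {u}) :
    Module.length Q ((⊥ : Ideal Q).colon (maximalIdeal Q : Set Q)) ≤ 1 := by
  have hu' : ∀ t ∈ maximalIdeal Q, t * u = 0 := fun t ht => by
    have : u ∈ (⊥ : Ideal Q).colon (maximalIdeal Q : Set Q) := by
      rw [hu]; exact Ideal.mem_span_singleton_self u
    simpa [mul_comm] using Submodule.mem_colon.1 this t ht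
  have : IsSimpleModule Q (Q ⧸ maximalIdeal Q) :=
    isSimpleModule_iff_isCoatom.2 (Ideal.isMaximal_def.1 (maximalIdeal.isMaximal Q))
  rw [hu, ← Module.length_eq_one Q (Q ⧸ maximalIdeal Q)]
  let φ : Q →ₗ[Q] Ideal.span {u} :=
    (LinearMap.toSpanSingleton Q Q u).codRestrict (Ideal.span {u})
      (fun c => Ideal.mul_mem_left _ _ (Ideal.mem_span_singleton_self u))
  refine Module.length_le_of_surjective
    ((maximalIdeal Q).liftQ φ fun t ht => Subtype.ext (hu' t ht)) ?_
  rintro ⟨x, hx⟩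
  obtain ⟨c, rfl⟩ := Ideal.mem_span_singleton'.1 hx
  exact ⟨Submodule.Quotient.mk c, rfl⟩

/-- Passing to an ideal of colength one decreases the length of the annihilator by at most one. -/
theorem length_annihilator_le_of_covBy [IsLocalRing Q]
    (hQ : Module.length Q ((⊥ : Ideal Q).colon (maximalIdeal Q : Set Q)) ≤ 1) {a b : Ideal Q}
    (hab : a ⋖ b) :
    Module.length Q ((⊥ : Ideal Q).colon (a : Set Q)) ≤
      Module.length Q ((⊥ : Ideal Q).colon (b : Set Q)) + 1 := by
  obtain ⟨x, hxb, hxa⟩ := SetLike.exists_of_lt hab.lt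
  have hsup : ∀ y ∈ b, y ∉ a → b ≤ a ⊔ Ideal.span {y} := by
    intro y hyb hya
    refine ((hab.eq_or_eq le_sup_left
      (sup_le hab.le ((Ideal.span_singleton_le_iff_mem _).2 hyb))).resolve_left fun h => ?_).ge
    exact hya (h ▸ Ideal.mem_sup_right (Ideal.mem_span_singleton_self y))
  -- Otherwise `t * x` and `a` generate `b`, so `x = i + r * t * x` with `i ∈ a`; since `1 - r * t`
  -- is a unit, `x ∈ a`.
  have hmx : ∀ t ∈ maximalIdeal Q, t * x ∈ a := by
    intro t ht
    by_contra hta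
    obtain ⟨i, hi, e, he, h⟩ := Submodule.mem_sup.1 (hsup _ (b.mul_mem_left t hxb) hta hxb)
    obtain ⟨r, rfl⟩ := Ideal.mem_span_singleton'.1 he
    refine hxa ?_
    have hunit : IsUnit (1 - r * t) := by
      by_contra hn
      have h1 : (1 - r * t) + r * t ∈ maximalIdeal Q :=
        add_mem ((mem_maximalIdeal _).2 hn) (Ideal.mul_mem_left _ _ ht)
      rw [sub_add_cancel] at h1
      exact (Ideal.ne_top_iff_one _).1 (maximalIdeal.isMaximal Q).ne_top h1
    rw [← Ideal.unit_mul_mem_iff_mem a hunit]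
    rw [show (1 - r * t) * x = i by linear_combination -h]
    exact hi
  let A := (⊥ : Ideal Q).colon (a : Set Q)
  have hA : ∀ c ∈ A, ∀ y ∈ a, c * y = 0 := fun c hc y hy => by
    simpa using Submodule.mem_colon.1 hc y hy
  -- Multiplication by `x` sends the annihilator of `a` into the socle, and its kernel annihilates
  -- `a + (x) = b`.
  let φ : A →ₗ[Q] (⊥ : Ideal Q).colon (maximalIdeal Q : Set Q) :=
    ((LinearMap.toSpanSingleton Q Q x).comp A.subtype).codRestrict _ (fun c => by
      refine Submodule.mem_colon.2 fun t ht => ?_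
      have := hA c c.2 _ (hmx t ht)
      simp only [LinearMap.comp_apply, Submodule.subtype_apply, LinearMap.toSpanSingleton_apply,
        smul_eq_mul, Submodule.mem_bot]
      linear_combination this)
  have hker : ∀ c : LinearMap.ker φ, ((c : A) : Q) ∈ (⊥ : Ideal Q).colon (b : Set Q) := by
    rintro ⟨c, hc⟩
    have hc : (c : Q) * x = 0 := congrArg Subtype.val hc
    refine Submodule.mem_colon.2 fun y hy => ?_
    obtain ⟨i, hi, e, he, rfl⟩ := Submodule.mem_sup.1 (hsup x hxb hxa hy)
    obtain ⟨r, rfl⟩ := Ideal.mem_span_singleton'.1 he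
    simp only [smul_eq_mul, Submodule.mem_bot]
    linear_combination hA c c.2 i hi + r * hc
  rw [Module.length_eq_add_of_exact (LinearMap.ker φ).subtype φ.rangeRestrict
    (Submodule.injective_subtype _) φ.surjective_rangeRestrict
    (by rw [LinearMap.exact_iff]; simp)]
  refine add_le_add ?_ ((Module.length_le_of_injective _ (Submodule.injective_subtype _)).trans hQ)
  exact Module.length_le_of_injective
    ((A.subtype.comp (LinearMap.ker φ).subtype).codRestrict _ hker)
    (fun c d h => Subtype.ext (Subtype.ext (congrArg
      (fun z : (⊥ : Ideal Q).colon (b : Set Q) => (z : Q)) h)))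

/-- In an Artinian local ring with simple socle, every ideal is the annihilator of its
annihilator. -/
theorem annihilator_annihilator_le [IsLocalRing Q] [IsArtinianRing Q] {u : Q}
    (hu : (⊥ : Ideal Q).colon (maximalIdeal Q : Set Q) = Ideal.span {u}) (a : Ideal Q) :
    (⊥ : Ideal Q).colon (((⊥ : Ideal Q).colon (a : Set Q) : Ideal Q) : Set Q) ≤ a := by
  set ann : Ideal Q → Ideal Q := fun a => (⊥ : Ideal Q).colon (a : Set Q) with hann
  have step : ∀ {a b : Ideal Q}, a ⋖ b → Order.height (ann a) ≤ Order.height (ann b) + 1 := by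
    intro a b h
    simpa only [Module.length_submodule] using
      length_annihilator_le_of_covBy (length_annihilator_le_one hu) h
  have mono := Submodule.height_strictMono (R := Q) (M := Q)
  -- Heights in the lattice of ideals are lengths. Climbing from `⊥` gives `lower` and descending
  -- from `⊤` gives `upper`; together, `a` and its annihilator have complementary lengths.
  have lower : ∀ a : Ideal Q, Order.height (⊤ : Ideal Q) ≤ Order.height (ann a) + Order.height a := by
    intro a
    induction a using WellFoundedLT.induction with
    | ind a ih =>
      by_cases h : IsMin a
      · obtain rfl := h.eq_bot
        have : ann ⊥ = ⊤ := Submodule.colon_bot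
        simp [this]
      · obtain ⟨c, hc⟩ := exists_covBy_of_wellFoundedGT h
        calc _ ≤ Order.height (ann c) + Order.height c := ih c hc.lt
          _ ≤ Order.height (ann a) + 1 + Order.height c := by gcongr; exact step hc
          _ = Order.height (ann a) + (Order.height c + 1) := by ring
          _ ≤ _ := by gcongr; exact Order.add_one_le_of_lt (mono hc.lt)
  have upper : ∀ a : Ideal Q, Order.height (ann a) + Order.height a ≤ Order.height (⊤ : Ideal Q) := by
    intro a
    induction a using WellFoundedGT.induction with
    | ind a ih =>
      by_cases h : IsMax a
      · obtain rfl := h.eq_top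
        have : ann ⊤ = ⊥ := eq_bot_iff.2 fun c hc => by
          simpa using Submodule.mem_colon.1 hc 1 trivial
        simp [this]
      · obtain ⟨c, hc⟩ := exists_covBy_of_wellFoundedLT h
        calc _ ≤ Order.height (ann c) + 1 + Order.height a := by gcongr; exact step hc
          _ = Order.height (ann c) + (Order.height a + 1) := by ring
          _ ≤ Order.height (ann c) + Order.height c := by
            gcongr; exact Order.add_one_le_of_lt (mono hc.lt)
          _ ≤ _ := ih c hc.lt
  have hle : a ≤ ann (ann a) := fun x hx => Submodule.mem_colon.2 fun c hc => by
    simpa [mul_comm] using Submodule.mem_colon.1 hc x hx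
  have hann3 : ann a ≤ ann (ann (ann a)) := fun x hx => Submodule.mem_colon.2 fun c hc => by
    simpa [mul_comm] using Submodule.mem_colon.1 hc x hx
  by_contra hcon
  have hlt : a < ann (ann a) := lt_of_le_not_ge hle hcon
  -- Since `ann a ≤ ann (ann (ann a))`, the two bounds give `ann (ann a)` no greater length than
  -- `a`.
  have h1 := lower a
  have h2 := upper (ann (ann a))
  have h3 : Order.height (ann a) + Order.height (ann (ann a)) ≤
      Order.height (ann a) + Order.height a :=
    (add_le_add_left (mono.monotone hann3) _).trans (h2.trans h1)
  have := (ENat.add_le_add_iff_left (Submodule.height_lt_top (ann a)).ne).1 h3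
  exact absurd (mono hlt) (not_lt.2 this)

variable {R : Type*} [CommRing R]

/-- Colons into `q` become annihilators in `R ⧸ q`, so the Artinian statement pulls back to ideals
above `q`. -/
theorem colon_colon_le_of_socleRankLE_one [IsLocalRing R] {q : Ideal R}
    [IsArtinianRing (R ⧸ q)] (hs : SocleRankLE (maximalIdeal R) 1 q) {a : Ideal R} (hqa : q ≤ a) :
    q.colon ((q.colon (a : Set R) : Ideal R) : Set R) ≤ a := by
  by_cases hq : q = ⊤
  · exact le_top.trans (hq.symm.trans_le hqa)
  have : Nontrivial (R ⧸ q) := Ideal.Quotient.nontrivial_iff.2 hq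
  have hloc : IsLocalRing (R ⧸ q) :=
    IsLocalRing.of_surjective' (Ideal.Quotient.mk q) Ideal.Quotient.mk_surjective
  have hcol : ∀ (b : Ideal R) (x : R),
      x ∈ q.colon (b : Set R) ↔ Ideal.Quotient.mk q x ∈
        (⊥ : Ideal (R ⧸ q)).colon (b.map (Ideal.Quotient.mk q) : Set (R ⧸ q)) := by
    intro b x
    simp only [Submodule.mem_colon, SetLike.mem_coe, smul_eq_mul, Submodule.mem_bot]
    constructor
    · intro h y hy
      obtain ⟨z, hz, rfl⟩ := (Ideal.mem_map_iff_of_surjective _ Ideal.Quotient.mk_surjective).1 hy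
      rw [← map_mul]
      exact Ideal.Quotient.eq_zero_iff_mem.2 (h z hz)
    · intro h y hy
      have := h _ (Ideal.mem_map_of_mem _ hy)
      rw [← map_mul] at this
      exact Ideal.Quotient.eq_zero_iff_mem.1 this
  have hmap : ∀ b : Ideal R, (q.colon (b : Set R)).map (Ideal.Quotient.mk q) =
      (⊥ : Ideal (R ⧸ q)).colon (b.map (Ideal.Quotient.mk q) : Set (R ⧸ q)) := by
    intro b
    ext y
    obtain ⟨y, rfl⟩ := Ideal.Quotient.mk_surjective y
    rw [← hcol, ← Ideal.mem_comap, Ideal.comap_map_of_surjective' _ Ideal.Quotient.mk_surjective,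
      Ideal.mk_ker, sup_eq_left.2 Ideal.le_colon]
  have hm : maximalIdeal (R ⧸ q) = (maximalIdeal R).map (Ideal.Quotient.mk q) :=
    (map_maximalIdeal_of_surjective _ Ideal.Quotient.mk_surjective).symm
  obtain ⟨s, hs1, hs⟩ := hs
  obtain ⟨u, hu⟩ : ∃ u : R, Ideal.span (s : Set R) = Ideal.span {u} := by
    rcases Finset.card_le_one_iff_subset_singleton.1 hs1 with ⟨u, hu⟩
    rcases Finset.subset_singleton_iff.1 hu with rfl | rfl
    · exact ⟨0, by simp⟩
    · exact ⟨u, by simp⟩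
  have hu' : (⊥ : Ideal (R ⧸ q)).colon (maximalIdeal (R ⧸ q) : Set (R ⧸ q)) =
      Ideal.span {Ideal.Quotient.mk q u} := by
    rw [hm, ← hmap, hs, hu, Ideal.map_sup, Ideal.map_quotient_self, bot_sup_eq, Ideal.map_span,
      Set.image_singleton]
  intro x hx
  rw [hcol, hmap] at hx
  have := annihilator_annihilator_le hu' _ hx
  rw [← Ideal.mem_comap, Ideal.comap_map_of_surjective' _ Ideal.Quotient.mk_surjective,
    Ideal.mk_ker, sup_eq_left.2 hqa] at this
  exact this

/-! ### Passing from the quotients by `(J, lᴺ)` to the quotient by `J` -/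

/-- Artin–Rees for colon ideals: `(J, lᴺ) : h` is contained in `(J : h, lᴺ⁻ᵏ)`. -/
theorem exists_colon_sup_span_pow_le [IsNoetherianRing R] (J h : Ideal R) (l : R) :
    ∃ k : ℕ, ∀ N ≥ k, (J ⊔ Ideal.span {l ^ N}).colon (h : Set R) ≤
      J.colon (h : Set R) ⊔ Ideal.span {l ^ (N - k)} := by
  obtain ⟨r, g, hg⟩ := Submodule.fg_iff_exists_fin_generating_family.1
    (IsNoetherian.noetherian h)
  have hgh : ∀ i, g i ∈ h := fun i => hg ▸ Submodule.subset_span ⟨i, rfl⟩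
  -- With `v` the vector of generators of `h`, the ideal `J : h` is the annihilator of `v`, and `b ∈
  -- (J, lᴺ) : h` means `b • v ∈ lᴺ (R ⧸ J)^r`. Artin–Rees is applied to the submodule `R v`.
  let v : Fin r → R ⧸ J := fun i => Ideal.Quotient.mk J (g i)
  obtain ⟨k, hk⟩ := (Ideal.span {l}).exists_pow_inf_eq_pow_smul (Submodule.span R {v})
  refine ⟨k, fun N hN b hb => ?_⟩
  have hb1 : b • v ∈ (Ideal.span {l} ^ N • ⊤ : Submodule R (Fin r → R ⧸ J)) := by
    have : ∀ i, ∃ c, b * g i - c * l ^ N ∈ J := by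
      intro i
      obtain ⟨j, hj, e, he, h⟩ := Submodule.mem_sup.1 (Submodule.mem_colon.1 hb _ (hgh i))
      obtain ⟨c, rfl⟩ := Ideal.mem_span_singleton'.1 he
      exact ⟨c, by rw [← smul_eq_mul b, ← h, add_sub_cancel_right]; exact hj⟩
    choose c hc using this
    have : b • v = l ^ N • fun i => Ideal.Quotient.mk J (c i) := by
      funext i
      change Ideal.Quotient.mk J (b * g i) = Ideal.Quotient.mk J (l ^ N * c i)
      rw [Ideal.Quotient.eq, mul_comm (l ^ N)]
      exact hc i
    rw [this, Ideal.span_singleton_pow]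
    exact Submodule.smul_mem_smul (Ideal.mem_span_singleton_self _) trivial
  have hb2 : b • v ∈ (Ideal.span {l} ^ (N - k) • Submodule.span R {v} :
      Submodule R (Fin r → R ⧸ J)) := by
    refine Submodule.smul_mono le_rfl (inf_le_right (a := Ideal.span {l} ^ k • ⊤)) ?_
    rw [← hk N hN]
    exact ⟨hb1, Submodule.smul_mem _ _ (Submodule.mem_span_singleton_self v)⟩
  rw [Ideal.span_singleton_pow, Submodule.ideal_span_singleton_smul] at hb2
  obtain ⟨w, hw, hwb⟩ := hb2
  obtain ⟨c, rfl⟩ := Submodule.mem_span_singleton.1 hw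
  refine Submodule.mem_sup.2 ⟨b - c * l ^ (N - k), ?_, c * l ^ (N - k),
    Ideal.mul_mem_left _ _ (Ideal.mem_span_singleton_self _), by ring⟩
  rw [← hg, Submodule.colon_span]
  refine Submodule.mem_colon.2 ?_
  rintro _ ⟨i, rfl⟩
  have := congrFun hwb i
  change Ideal.Quotient.mk J (l ^ (N - k) * (c * g i)) = Ideal.Quotient.mk J (b * g i) at this
  rw [eq_comm, Ideal.Quotient.eq] at this
  rw [smul_eq_mul, show (b - c * l ^ (N - k)) * g i = b * g i - l ^ (N - k) * (c * g i) by ring]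
  exact this

/-- Krull's intersection theorem in `R ⧸ h`. -/
theorem mem_of_forall_mem_sup_span_pow [IsNoetherianRing R] [IsLocalRing R] {h : Ideal R} {l a : R}
    (hl : l ∈ maximalIdeal R) {k : ℕ} (ha : ∀ N ≥ k, a ∈ h ⊔ Ideal.span {l ^ N}) : a ∈ h := by
  have hlt : Ideal.span {l} ≠ ⊤ := fun h =>
    (maximalIdeal.isMaximal R).ne_top (top_le_iff.1 (h ▸ (Ideal.span_singleton_le_iff_mem _).2 hl))
  have := Ideal.iInf_pow_smul_eq_bot_of_isLocalRing (M := R ⧸ h) _ hlt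
  have hmem : Ideal.Quotient.mk h a ∈ (⨅ i : ℕ, Ideal.span {l} ^ i • ⊤ : Submodule R (R ⧸ h)) := by
    refine (Submodule.mem_iInf _).2 fun i => ?_
    obtain ⟨y, hy, e, he, rfl⟩ := Submodule.mem_sup.1 (ha (max i k) (le_max_right _ _))
    obtain ⟨c, rfl⟩ := Ideal.mem_span_singleton'.1 he
    rw [map_add, Ideal.Quotient.eq_zero_iff_mem.2 hy, zero_add]
    have : Ideal.Quotient.mk h (c * l ^ max i k) =
        l ^ max i k • Ideal.Quotient.mk h c := by
      rw [mul_comm]; rfl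
    rw [this, Ideal.span_singleton_pow]
    exact Submodule.smul_mem_smul (Ideal.mem_span_singleton.2 (pow_dvd_pow _ (le_max_left _ _)))
      trivial
  rw [this] at hmem
  exact Ideal.Quotient.eq_zero_iff_mem.1 hmem

/-- If all `R ⧸ (J, lᴺ)` have the double annihilator property, then so does `R ⧸ J` for the ideals
modulo which `l` is regular. -/
theorem colon_colon_le_of_regularModulo [IsNoetherianRing R] [IsLocalRing R] {J h : Ideal R} {l : R}
    (hJh : J ≤ h) (hl : l ∈ maximalIdeal R) (hlh : RegularModulo h l)
    (hN : ∀ (N : ℕ) (a : Ideal R), J ⊔ Ideal.span {l ^ N} ≤ a →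
      (J ⊔ Ideal.span {l ^ N}).colon
        (((J ⊔ Ideal.span {l ^ N}).colon (a : Set R) : Ideal R) : Set R) ≤ a) :
    J.colon ((J.colon (h : Set R) : Ideal R) : Set R) ≤ h := by
  intro a ha
  obtain ⟨k, hk⟩ := exists_colon_sup_span_pow_le J h l
  -- Artin–Rees loses `k` powers of `l`, so `l ^ k * a` is tested in place of `a`; regularity of `l`
  -- modulo `h` cancels the factor.
  refine hlh.pow k a (mem_of_forall_mem_sup_span_pow hl (k := k) fun N hNk => ?_)
  refine hN N _ (sup_le_sup_right hJh _) (Submodule.mem_colon.2 fun b hb => ?_)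
  obtain ⟨c, hc, e, he, rfl⟩ := Submodule.mem_sup.1
    (hk N hNk (Submodule.colon_mono le_rfl (SetLike.coe_subset_coe.2 le_sup_left) hb))
  obtain ⟨r, rfl⟩ := Ideal.mem_span_singleton'.1 he
  have hac := Submodule.mem_colon.1 ha c hc
  have : (l ^ k * a) • (c + r * l ^ (N - k)) = l ^ k * (a • c) + a * r * l ^ N := by
    rw [← Nat.sub_add_cancel hNk, pow_add]; simp; ring
  rw [this]
  exact add_mem (Ideal.mem_sup_left (J.mul_mem_left _ hac))
    (Ideal.mem_sup_right (Ideal.mul_mem_left _ _ (Ideal.mem_span_singleton_self _)))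

end DoubleAnnihilator

end GradedLinkage

namespace GradedLinkage

open IsLocalRing

/-! ### The Gorenstein property of a local complete intersection -/

section Local

variable {R : Type*} [CommRing R] [IsNoetherianRing R]

/-- If a maximal ideal is not associated to `R ⧸ I`, it contains a nonzerodivisor of `R ⧸ I`. -/
theorem exists_regularModulo_of_notMem_associatedPrimes {m I : Ideal R} [hm : m.IsMaximal]
    (h : m ∉ associatedPrimes R (R ⧸ I)) : ∃ x ∈ m, RegularModulo I x := by
  by_contra! hcon
  have hsub : (m : Set R) ⊆ ⋃ p ∈ associatedPrimes R (R ⧸ I), ((id p : Ideal R) : Set R) := by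
    simp only [id]
    rw [biUnion_associatedPrimes_eq_compl_regular]
    intro z hz
    exact fun h => hcon z hz (regularModulo_iff_isSMulRegular.2 h)
  obtain ⟨P, hP, hle⟩ := (Ideal.subset_union_prime_finite (associatedPrimes.finite R (R ⧸ I))
    (f := id) ⊥ ⊥ (fun P hP _ _ => hP.isPrime)).1 hsub
  exact h (hm.eq_of_le hP.isPrime.ne_top hle ▸ hP)

theorem exists_forall_mem_iff_of_mem_associatedPrimes {P I : Ideal R}
    (hP : P ∈ associatedPrimes R (R ⧸ I)) : ∃ a, ∀ t, t ∈ P ↔ t * a ∈ I := by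
  obtain ⟨-, x, hx⟩ := isAssociatedPrime_iff.1 hP
  obtain ⟨a, rfl⟩ := Ideal.Quotient.mk_surjective x
  refine ⟨a, fun t => ?_⟩
  rw [hx, Submodule.mem_colon_singleton, Submodule.mem_bot, ← Ideal.Quotient.eq_zero_iff_mem]
  rfl

theorem SocleRankLE.notMem_associatedPrimes {m I : Ideal R} (h : SocleRankLE m 0 I) :
    m ∉ associatedPrimes R (R ⧸ I) := by
  intro hP
  obtain ⟨a, hmem⟩ := exists_forall_mem_iff_of_mem_associatedPrimes hP
  have ha : a ∈ I := socleRankLE_zero_iff.1 h a fun t ht => (hmem t).1 ht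
  exact hP.isPrime.ne_top ((Ideal.eq_top_iff_one _).2 ((hmem 1).2 (by simpa using ha)))

theorem SocleRankLE.exists_regularModulo {m I : Ideal R} [hm : m.IsMaximal]
    (h : SocleRankLE m 0 I) : ∃ x ∈ m, RegularModulo I x :=
  exists_regularModulo_of_notMem_associatedPrimes h.notMem_associatedPrimes

theorem ringKrullDim_le_length [IsLocalRing R] {xs : List R} (hxs : maximalIdeal R = Ideal.ofList xs) :
    ringKrullDim R ≤ xs.length := by
  classical
  have h : maximalIdeal R ∈ (Ideal.span (xs.toFinset : Set R)).minimalPrimes := by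
    rw [List.coe_toFinset, show Ideal.span {r | r ∈ xs} = Ideal.ofList xs from rfl, ← hxs,
      Ideal.minimalPrimes_eq_subsingleton_self]
    rfl
  have := Ideal.height_le_card_of_mem_minimalPrimes_span_finset h
  rw [← IsLocalRing.maximalIdeal_height_eq_ringKrullDim]
  have h2 : (xs.toFinset.card : ℕ∞) ≤ xs.length := by exact_mod_cast xs.toFinset_card_le
  exact_mod_cast this.trans h2

section

variable [IsLocalRing R] {xs fs : List R} {x : R}

/-- Modulo `xs` the remaining parameter `x` is regular, so there is no socle; exchange transfers
this to `fs`, of the same length. -/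
theorem socleRankLE_zero_of_regular (hxs : maximalIdeal R = Ideal.ofList (xs ++ [x]))
    (hx : RegularSeqModulo ⊥ (xs ++ [x])) (hlen : fs.length = xs.length)
    (hfm : ∀ f ∈ fs, f ∈ maximalIdeal R) (hf : RegularSeqModulo ⊥ fs) :
    SocleRankLE (maximalIdeal R) 0 (Ideal.ofList fs) := by
  have hmem : ∀ y ∈ xs ++ [x], y ∈ maximalIdeal R := fun y hy => by
    rw [hxs]; exact Ideal.subset_span hy
  obtain ⟨hx1, hx2⟩ := regularSeqModulo_append.1 hx
  rw [regularSeqModulo_singleton] at hx2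
  have := SocleRankLE.exchange_list (k := 0) hlen.symm
    (fun y hy => hmem y (List.mem_append_left _ hy)) hfm hx1 hf
    (socleRankLE_zero_iff.2 fun a ha => hx2 a (ha x (hmem x (by simp))))
  rwa [bot_sup_eq] at this

/-- A regular local ring modulo a regular sequence of colength one is Gorenstein: ideals without
embedded component satisfy the double annihilator property. -/
theorem colon_colon_le_of_regular (hxs : maximalIdeal R = Ideal.ofList (xs ++ [x]))
    (hx : RegularSeqModulo ⊥ (xs ++ [x])) (hlen : fs.length = xs.length)
    (hfm : ∀ f ∈ fs, f ∈ maximalIdeal R) (hf : RegularSeqModulo ⊥ fs) {h : Ideal R}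
    (hfh : Ideal.ofList fs ≤ h) (hh : ∃ y ∈ maximalIdeal R, RegularModulo h y) :
    (Ideal.ofList fs).colon (((Ideal.ofList fs).colon (h : Set R) : Ideal R) : Set R) ≤ h := by
  obtain ⟨y, hym, hy⟩ := hh
  obtain ⟨z, hzm, hz⟩ :=
    (socleRankLE_zero_of_regular hxs hx hlen hfm hf).exists_regularModulo
  obtain ⟨l, hlm, hl, hlf⟩ := exists_mem_regularModulo hym hy hzm hz
  refine colon_colon_le_of_regularModulo hfh hlm hl fun N a hNa => ?_
  -- `l ^ 0 = 1` is not in the maximal ideal, so `N = 0` must be separated; there the quotient is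
  -- zero.
  rcases N.eq_zero_or_pos with rfl | hN
  · have : a = ⊤ := top_le_iff.1 (by simpa using hNa)
    rw [this]
    exact le_top
  have hlN : l ^ N ∈ maximalIdeal R := Ideal.pow_mem_of_mem _ hlm N hN
  have hreg : RegularSeqModulo ⊥ (fs ++ [l ^ N]) :=
    regularSeqModulo_append.2 ⟨hf, by
      rw [regularSeqModulo_singleton, bot_sup_eq]; exact hlf.pow N⟩
  have hq : Ideal.ofList fs ⊔ Ideal.span {l ^ N} = ⊥ ⊔ Ideal.ofList (fs ++ [l ^ N]) := by
    rw [Ideal.ofList_append, Ideal.ofList_singleton, bot_sup_eq]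
  rw [hq] at hNa ⊢
  have hdim := ringKrullDim_quotient_sup_add_length_le hreg
  -- `fs ++ [l ^ N]` has as many terms as a generating list of the maximal ideal, whose length
  -- bounds `dim R`; hence the quotient has dimension at most zero.
  have hart : IsArtinianRing (R ⧸ (⊥ ⊔ Ideal.ofList (fs ++ [l ^ N]))) := by
    rw [isArtinianRing_iff_krullDimLE_zero, Ring.krullDimLE_iff]
    have h2 := (hdim.trans (ringKrullDim_quotient_le _)).trans (ringKrullDim_le_length hxs)
    have h3 : (fs ++ [l ^ N]).length = (xs ++ [x]).length := by simp [hlen]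
    rw [h3] at h2
    generalize ringKrullDim (R ⧸ (⊥ ⊔ Ideal.ofList (fs ++ [l ^ N]))) = D at h2
    generalize (xs ++ [x]).length = n at h2
    induction D with
    | bot => exact bot_le
    | coe D =>
      have h4 : D + (n : ℕ∞) ≤ 0 + n := by rw [zero_add]; exact_mod_cast h2
      have := (ENat.add_le_add_iff_right (ENat.natCast_ne_top n)).1 h4
      exact_mod_cast this
  refine colon_colon_le_of_socleRankLE_one ?_ hNa
  refine SocleRankLE.exchange_list (xs := xs ++ [x]) (by simp [hlen])
    (fun y hy => by rw [hxs]; exact Ideal.subset_span hy) (fun y hy => ?_) hx hreg ?_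
  · rcases List.mem_append.1 hy with hy | hy
    · exact hfm y hy
    · rw [List.mem_singleton.1 hy]; exact hlN
  · rw [bot_sup_eq, ← hxs]
    exact socleRankLE_one_self _

end

end Local

/-! ### Descent from the localization at a maximal ideal -/

section Localization

variable {S : Type*} [CommRing S] {m : Ideal S}

theorem algebraMap_mem_map_iff [m.IsPrime] {I : Ideal S} {a : S} :
    algebraMap S (Localization.AtPrime m) a ∈ I.map (algebraMap S (Localization.AtPrime m)) ↔
      ∃ s ∉ m, s * a ∈ I := by
  rw [IsLocalization.algebraMap_mem_map_algebraMap_iff m.primeCompl]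
  rfl

theorem RegularModulo.localization [m.IsPrime] {I : Ideal S} {x : S} (h : RegularModulo I x) :
    RegularModulo (I.map (algebraMap S (Localization.AtPrime m)))
      (algebraMap S (Localization.AtPrime m) x) := by
  intro a ha
  obtain ⟨b, s, rfl⟩ := IsLocalization.exists_mk'_eq m.primeCompl a
  rw [← IsLocalization.mk'_one (M := m.primeCompl) (Localization.AtPrime m) x,
    ← IsLocalization.mk'_mul, IsLocalization.mk'_mem_iff] at ha
  obtain ⟨t, ht, hta⟩ := algebraMap_mem_map_iff.1 ha
  refine IsLocalization.mk'_mem_iff.2 (algebraMap_mem_map_iff.2 ⟨t, ht, h _ ?_⟩)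
  rwa [mul_left_comm]

theorem RegularSeqModulo.localization [m.IsPrime] {I : Ideal S} {xs : List S}
    (h : RegularSeqModulo I xs) :
    RegularSeqModulo (I.map (algebraMap S (Localization.AtPrime m)))
      (xs.map (algebraMap S (Localization.AtPrime m))) := by
  induction xs generalizing I with
  | nil => trivial
  | cons x xs ih =>
    refine ⟨h.1.localization, ?_⟩
    have := ih h.2
    rwa [Ideal.map_sup, Ideal.map_span, Set.image_singleton] at this

/-- The denominator `s` is invertible modulo `m`, and `m` already multiplies `a` into `I`. -/
theorem mem_of_algebraMap_mem_map [hm : m.IsMaximal] {I : Ideal S} {a : S}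
    (ha : ∀ t ∈ m, t * a ∈ I)
    (h : algebraMap S (Localization.AtPrime m) a ∈ I.map (algebraMap S (Localization.AtPrime m))) :
    a ∈ I := by
  obtain ⟨s, hs, hsa⟩ := algebraMap_mem_map_iff.1 h
  obtain ⟨y, i, hi, h1⟩ := hm.exists_inv hs
  have : a = y * (s * a) + i * a := by linear_combination (-a) * h1
  rw [this]
  exact add_mem (I.mul_mem_left _ hsa) (ha i hi)

variable [IsNoetherianRing S] {xs fs : List S} {x : S}

section

variable [hmax : m.IsMaximal]

theorem socleRankLE_zero_ofList (hxs : m = Ideal.ofList (xs ++ [x]))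
    (hx : RegularSeqModulo ⊥ (xs ++ [x])) (hlen : fs.length = xs.length)
    (hfm : ∀ f ∈ fs, f ∈ m) (hf : RegularSeqModulo ⊥ fs) :
    SocleRankLE m 0 (Ideal.ofList fs) := by
  let φ := algebraMap S (Localization.AtPrime m)
  have hM : maximalIdeal (Localization.AtPrime m) = m.map φ :=
    (Localization.AtPrime.map_eq_maximalIdeal).symm
  have key := socleRankLE_zero_of_regular (R := Localization.AtPrime m) (xs := xs.map φ)
    (x := φ x) (fs := fs.map φ)
    (hM.trans ((congrArg (Ideal.map φ) hxs).trans (by rw [Ideal.map_ofList, List.map_append]; rfl)))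
    (by simpa using hx.localization (m := m)) (by simpa using hlen)
    (by
      intro y hy
      obtain ⟨f, hfs, rfl⟩ := List.mem_map.1 hy
      rw [hM]
      exact Ideal.mem_map_of_mem _ (hfm f hfs))
    (by simpa using hf.localization (m := m))
  rw [socleRankLE_zero_iff] at key ⊢
  intro a ha
  refine mem_of_algebraMap_mem_map ha ?_
  rw [Ideal.map_ofList]
  refine key _ fun t ht => ?_
  rw [hM] at ht
  have hle : m.map φ ≤ (Ideal.ofList (fs.map φ)).colon {φ a} := Ideal.map_le_iff_le_comap.2 fun t ht => by
    rw [Ideal.mem_comap, Submodule.mem_colon_singleton, smul_eq_mul, ← map_mul,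
      ← Ideal.map_ofList]
    exact Ideal.mem_map_of_mem _ (ha t ht)
  simpa using Submodule.mem_colon_singleton.1 (hle ht)

/-- The double colon is taken to the local ring. Since `h` is finitely generated, an element of the
localized colon has a multiple by an element outside `m` in the colon over `S`: the product of the
denominators for the generators. -/
theorem exists_mul_mem_of_mem_colon_colon (hxs : m = Ideal.ofList (xs ++ [x]))
    (hx : RegularSeqModulo ⊥ (xs ++ [x])) (hlen : fs.length = xs.length)
    (hfm : ∀ f ∈ fs, f ∈ m) (hf : RegularSeqModulo ⊥ fs) {h : Ideal S}
    (hfh : Ideal.ofList fs ≤ h) (hh : SocleRankLE m 0 h) {a : S}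
    (ha : a ∈ (Ideal.ofList fs).colon (((Ideal.ofList fs).colon (h : Set S) : Ideal S) : Set S)) :
    ∃ s ∉ m, s * a ∈ h := by
  classical
  let φ := algebraMap S (Localization.AtPrime m)
  have hM : maximalIdeal (Localization.AtPrime m) = m.map φ :=
    (Localization.AtPrime.map_eq_maximalIdeal).symm
  obtain ⟨y, hym, hy⟩ := hh.exists_regularModulo
  have key := colon_colon_le_of_regular (R := Localization.AtPrime m) (xs := xs.map φ)
    (x := φ x) (fs := fs.map φ) (h := h.map φ)
    (hM.trans ((congrArg (Ideal.map φ) hxs).trans (by rw [Ideal.map_ofList, List.map_append]; rfl)))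
    (by simpa using hx.localization (m := m)) (by simpa using hlen)
    (by
      intro y hy
      obtain ⟨f, hfs, rfl⟩ := List.mem_map.1 hy
      rw [hM]
      exact Ideal.mem_map_of_mem _ (hfm f hfs))
    (by simpa using hf.localization (m := m))
    (by rw [← Ideal.map_ofList]; exact Ideal.map_mono hfh)
    ⟨φ y, by rw [hM]; exact Ideal.mem_map_of_mem _ hym, hy.localization⟩
  refine algebraMap_mem_map_iff.1 (key (Submodule.mem_colon.2 fun b hb => ?_))
  obtain ⟨c, s, rfl⟩ := IsLocalization.exists_mk'_eq m.primeCompl b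
  rw [SetLike.mem_coe, IsLocalization.mk'_mem_iff] at hb
  rw [smul_eq_mul, ← IsLocalization.mk'_one (M := m.primeCompl) (Localization.AtPrime m) a,
    ← IsLocalization.mk'_mul, IsLocalization.mk'_mem_iff, map_mul]
  obtain ⟨g, hg⟩ := IsNoetherian.noetherian h
  have hu : ∀ i ∈ g, ∃ u : S, u ∉ m ∧ u * (c * i) ∈ Ideal.ofList fs := by
    intro i hi
    have hih : i ∈ h := hg ▸ Ideal.subset_span hi
    have := Submodule.mem_colon.1 hb (φ i) (Ideal.mem_map_of_mem _ hih)
    rw [smul_eq_mul, ← map_mul, ← Ideal.map_ofList] at this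
    obtain ⟨u, hu, h⟩ := algebraMap_mem_map_iff.1 this
    exact ⟨u, hu, h⟩
  choose! u hum hu using hu
  have hprod : ∏ i ∈ g, u i ∉ m := by
    rw [hmax.isPrime.prod_mem_iff]
    push Not
    exact hum
  have hcol : (∏ i ∈ g, u i) * c ∈ (Ideal.ofList fs).colon (h : Set S) := by
    rw [← hg, Submodule.colon_span]
    refine Submodule.mem_colon.2 fun i hi => ?_
    obtain ⟨v, hv⟩ := Finset.dvd_prod_of_mem u hi
    rw [hv, smul_eq_mul, show u i * v * c * i = v * (u i * (c * i)) by ring]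
    exact Ideal.mul_mem_left _ _ (hu i hi)
  rw [← map_mul, ← Ideal.map_ofList]
  refine algebraMap_mem_map_iff.2 ⟨_, hprod, ?_⟩
  have := Submodule.mem_colon.1 ha _ hcol
  rwa [smul_eq_mul, mul_left_comm] at this

end

end Localization

end GradedLinkage

namespace GradedLinkage

open IsLocalRing

/-! ### Rings of dimension at most one without maximal associated primes -/

section DimensionOne

variable {Q : Type*} [CommRing Q]

theorem one_le_ringKrullDim {P : Ideal Q} (hP : P.IsPrime) (hmax : ¬ P.IsMaximal) :
    1 ≤ ringKrullDim Q := by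
  have h : ¬ ringKrullDim Q ≤ 0 := fun h =>
    hmax (Ring.krullDimLE_zero_iff.1 (Ring.krullDimLE_iff.2 h) P hP)
  generalize ringKrullDim Q = D at h
  induction D with
  | bot => exact absurd bot_le h
  | coe D =>
    have : 0 < D := by exact_mod_cast not_le.1 h
    exact_mod_cast Order.one_le_iff_pos.2 this

theorem mem_minimalPrimes_of_not_isMaximal (hdim : ringKrullDim Q ≤ 1) {P : Ideal Q}
    (hP : P.IsPrime) (hmax : ¬ P.IsMaximal) : P ∈ minimalPrimes Q :=
  (Ring.krullDimLE_one_iff.1 (Ring.krullDimLE_iff.2 (by exact_mod_cast hdim)) P hP).resolve_right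
    hmax

theorem hasNoEmbeddedComponents_of_forall_not_isMaximal (hdim : ringKrullDim Q ≤ 1)
    (hass : ∀ P ∈ associatedPrimes Q Q, ¬ P.IsMaximal) : HasNoEmbeddedComponents Q :=
  fun P hP => mem_minimalPrimes_of_not_isMaximal hdim hP.isPrime (hass P hP)

variable [IsNoetherianRing Q]

theorem mem_associatedPrimes_of_mem_minimalPrimes {P : Ideal Q} (hP : P ∈ minimalPrimes Q) :
    P ∈ associatedPrimes Q Q := by
  refine Module.associatedPrimes.minimalPrimes_annihilator_subset_associatedPrimes Q Q ?_
  rwa [Module.annihilator_eq_bot.2 inferInstance]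

section

variable (hdim : ringKrullDim Q ≤ 1) (hass : ∀ P ∈ associatedPrimes Q Q, ¬ P.IsMaximal)

include hdim hass

theorem ringKrullDim_eq_one [Nontrivial Q] : ringKrullDim Q = 1 := by
  obtain ⟨P, hP⟩ := associatedPrimes.nonempty Q Q
  exact le_antisymm hdim (one_le_ringKrullDim hP.isPrime (hass P hP))

theorem isEquidimensional_of_forall_not_isMaximal : IsEquidimensional Q := by
  intro P hP
  have hPp : P.IsPrime := hP.isPrime
  have hmax := hass P (mem_associatedPrimes_of_mem_minimalPrimes hP)
  have : Nontrivial Q := ⟨⟨0, 1, fun h => hPp.ne_top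
    ((Ideal.eq_top_iff_one _).2 (h ▸ P.zero_mem))⟩⟩
  rw [ringKrullDim_eq_one hdim hass]
  refine le_antisymm ((ringKrullDim_quotient_le P).trans hdim)
    (one_le_ringKrullDim (P := ⊥) Ideal.isPrime_bot fun h => hmax ?_)
  have := Ideal.comap_isMaximal_of_surjective (Ideal.Quotient.mk P) Ideal.Quotient.mk_surjective
    (K := ⊥)
  rwa [← RingHom.ker_eq_comap_bot, Ideal.mk_ker] at this

/-- By prime avoidance each maximal ideal contains a nonzerodivisor. It stays regular in the
localization, whose dimension is at most one, so it alone is the required sequence. -/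
theorem isCohenMacaulayRing_of_forall_not_isMaximal : IsCohenMacaulayRing Q := by
  refine ⟨inferInstance, fun m hm => ⟨inferInstance, ?_⟩⟩
  have hmass : m ∉ associatedPrimes Q (Q ⧸ (⊥ : Ideal Q)) := by
    rw [LinearEquiv.AssociatedPrimes.eq (Submodule.quotEquivOfEqBot (⊥ : Ideal Q) rfl)]
    exact fun h => hass m h hm
  obtain ⟨x, hxm, hx⟩ := exists_regularModulo_of_notMem_associatedPrimes hmass
  let y := algebraMap Q (Localization.AtPrime m) x
  have hym : y ∈ maximalIdeal (Localization.AtPrime m) := by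
    rw [← Localization.AtPrime.map_eq_maximalIdeal]
    exact Ideal.mem_map_of_mem _ hxm
  have hy : RegularModulo (⊥ : Ideal (Localization.AtPrime m)) y := by
    simpa using hx.localization (m := m)
  have hreg : RingTheory.Sequence.IsRegular (Localization.AtPrime m) [y] := by
    refine (IsLocalRing.isRegular_iff_isWeaklyRegular_of_subset_maximalIdeal (by simpa using hym)).2 ?_
    rw [RingTheory.Sequence.isWeaklyRegular_singleton_iff,
      isSMulRegular_iff_right_eq_zero_of_smul]
    intro a ha
    exact hy a ha
  refine ⟨[y], by simpa using hym, hreg, ?_⟩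
  have h1 := ringKrullDim_add_length_eq_ringKrullDim_of_isRegular _ hreg
  have hne : Nontrivial (Localization.AtPrime m ⧸ Ideal.ofList [y]) := by
    refine Ideal.Quotient.nontrivial_iff.2 fun h => ?_
    refine (maximalIdeal.isMaximal (Localization.AtPrime m)).ne_top (top_le_iff.1 (h ▸ ?_))
    simpa using hym
  have h0 : 0 ≤ ringKrullDim (Localization.AtPrime m ⧸ Ideal.ofList [y]) :=
    ringKrullDim_nonneg_of_nontrivial
  have h2 : ringKrullDim (Localization.AtPrime m) ≤ 1 := by
    rw [IsLocalization.AtPrime.ringKrullDim_eq_height m]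
    exact (Ideal.height_le_ringKrullDim_of_ne_top hm.ne_top).trans hdim
  refine le_antisymm ?_ (by simpa using h2)
  rw [← h1]
  calc ((([y] : List _).length : ℕ) : WithBot ℕ∞) = 0 + ([y].length : ℕ) := by simp
    _ ≤ _ := by gcongr

end

/-- Any associated prime of `Q ⧸ I` contains `I` and, not being maximal, is a minimal prime of `Q`.
-/
theorem height_eq_zero_of_forall_not_isMaximal (hdim : ringKrullDim Q ≤ 1) {I : Ideal Q}
    (hI : I ≠ ⊤) (hass : ∀ P ∈ associatedPrimes Q (Q ⧸ I), ¬ P.IsMaximal) : I.height = 0 := by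
  have := Ideal.Quotient.nontrivial_iff.2 hI
  obtain ⟨P, hP⟩ := associatedPrimes.nonempty Q (Q ⧸ I)
  have hPp := hP.isPrime
  obtain ⟨a, ha⟩ := exists_forall_mem_iff_of_mem_associatedPrimes hP
  have hle : I ≤ P := fun t ht => (ha t).2 (I.mul_mem_right _ ht)
  have h0 := Ideal.height_eq_zero_iff.2
    (mem_minimalPrimes_of_not_isMaximal hdim hPp (hass P hP))
  exact le_antisymm ((Ideal.height_mono hle).trans h0.le) bot_le

theorem comap_mem_associatedPrimes {I : Ideal Q} {P : Ideal (Q ⧸ I)}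
    (hP : P ∈ associatedPrimes (Q ⧸ I) (Q ⧸ I)) :
    P.comap (Ideal.Quotient.mk I) ∈ associatedPrimes Q (Q ⧸ I) := by
  obtain ⟨hp, x, hx⟩ := isAssociatedPrime_iff.1 hP
  refine isAssociatedPrime_iff.2 ⟨inferInstance, x, ?_⟩
  ext t
  rw [Ideal.mem_comap, hx, Submodule.mem_colon_singleton, Submodule.mem_colon_singleton]
  rfl

theorem not_isMaximal_of_mem_associatedPrimes_quotient {I : Ideal Q}
    (hass : ∀ P ∈ associatedPrimes Q (Q ⧸ I), ¬ P.IsMaximal) (P : Ideal (Q ⧸ I))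
    (hP : P ∈ associatedPrimes (Q ⧸ I) (Q ⧸ I)) : ¬ P.IsMaximal := fun _ =>
  hass _ (comap_mem_associatedPrimes hP)
    (Ideal.comap_isMaximal_of_surjective _ Ideal.Quotient.mk_surjective)

end DimensionOne

/-! ### The variables as a regular sequence -/

section Variables

open MvPolynomial

/-- Membership in an ideal generated by variables is read off the exponents, and multiplying by `Xᵢ`
does not change the exponents of the earlier variables. -/
theorem regularSeqModulo_variables (R : Type*) [CommRing R] [IsDomain R] (n : ℕ) :
    RegularSeqModulo ⊥ (List.ofFn (X : Fin n → MvPolynomial (Fin n) R)) := by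
  refine regularSeqModulo_of_forall fun i hi => ?_
  have hin : i < n := by simpa using hi
  have hspan : (⊥ ⊔ Ideal.ofList ((List.ofFn (X : Fin n → MvPolynomial (Fin n) R)).take i)) =
      Ideal.span (X '' {k : Fin n | (k : ℕ) < i}) := by
    rw [bot_sup_eq, Ideal.ofList]
    congr 1
    ext p
    simp only [Set.mem_ofPred_eq, Set.mem_image, List.mem_take_iff_getElem, List.getElem_ofFn,
      List.length_ofFn]
    constructor
    · rintro ⟨j, hj, rfl⟩
      exact ⟨⟨j, by omega⟩, by simp; omega, rfl⟩
    · rintro ⟨k, hk, rfl⟩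
      exact ⟨k, by omega, rfl⟩
  rw [hspan, List.getElem_ofFn]
  intro a ha
  rw [mem_ideal_span_X_image] at ha ⊢
  intro e he
  obtain ⟨k, hk, hk0⟩ := ha (Finsupp.single ⟨i, hin⟩ 1 + e) (by
    rw [mem_support_iff] at he ⊢
    rwa [coeff_X_mul])
  refine ⟨k, hk, ?_⟩
  have : (⟨i, hin⟩ : Fin n) ≠ k := fun h => by subst h; simp at hk
  simpa [Finsupp.single_apply, this] using hk0

end Variables

end GradedLinkage

noncomputable section

namespace GradedLinkage

open DirectSum

/-! ### Homogeneous ideals and their associated primes -/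

section Graded

variable {𝕜 T : Type*} [Field 𝕜] [CommRing T] [Algebra 𝕜 T] (𝒯 : ℕ → Submodule 𝕜 T)
  [GradedAlgebra 𝒯]

theorem mem_irrelevant_iff_decompose {x : T} :
    x ∈ (HomogeneousIdeal.irrelevant 𝒯).toIdeal ↔ (decompose 𝒯 x 0 : T) = 0 :=
  Iff.rfl

variable {𝒯}

omit [GradedAlgebra 𝒯] in
theorem isUnit_of_mem_zero (h0 : 𝒯 0 = 1) {x : T} (hx : x ∈ 𝒯 0) (hne : x ≠ 0) : IsUnit x := by
  rw [h0, Submodule.mem_one] at hx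
  obtain ⟨c, rfl⟩ := hx
  exact (IsUnit.mk0 c fun h => hne (by simp [h])).map (algebraMap 𝕜 T)

theorem le_irrelevant (h0 : 𝒯 0 = 1) {P : Ideal T} (hP : P.IsHomogeneous 𝒯) (hne : P ≠ ⊤) :
    P ≤ (HomogeneousIdeal.irrelevant 𝒯).toIdeal := by
  intro x hx
  by_contra hx0
  exact hne (Ideal.eq_top_of_isUnit_mem P (hP 0 hx)
    (isUnit_of_mem_zero h0 (SetLike.coe_mem _) hx0))

theorem isMaximal_irrelevant [Nontrivial T] (h0 : 𝒯 0 = 1) :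
    (HomogeneousIdeal.irrelevant 𝒯).toIdeal.IsMaximal := by
  refine Ideal.isMaximal_iff.2 ⟨fun h => ?_, fun I x hle hx hxI => ?_⟩
  · rw [mem_irrelevant_iff_decompose, decompose_of_mem_same 𝒯 SetLike.GradedOne.one_mem] at h
    exact one_ne_zero h
  · have hsub : x - (decompose 𝒯 x 0 : T) ∈ (HomogeneousIdeal.irrelevant 𝒯).toIdeal := by
      rw [mem_irrelevant_iff_decompose, decompose_sub, decompose_coe]
      simp
    have hmem : (decompose 𝒯 x 0 : T) ∈ I := by
      simpa using I.sub_mem hxI (hle hsub)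
    rw [← Ideal.eq_top_iff_one]
    exact Ideal.eq_top_of_isUnit_mem I hmem (isUnit_of_mem_zero h0 (SetLike.coe_mem _) hx)

theorem decompose_mul_eq_sum (x y : T) (n : ℕ) :
    (decompose 𝒯 (x * y) n : T) = ∑ p ∈ Finset.HasAntidiagonal.antidiagonal n,
      (decompose 𝒯 x p.1 : T) * (decompose 𝒯 y p.2 : T) := by
  rw [decompose_mul, coe_mul_apply_eq_sum_antidiagonal]

theorem exists_forall_decompose_eq_zero (x : T) :
    ∃ N, ∀ i ≥ N, (decompose 𝒯 x i : T) = 0 := by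
  classical
  refine ⟨((decompose 𝒯 x).support).sup id + 1, fun i hi => ?_⟩
  by_contra h
  have : i ∈ (decompose 𝒯 x).support := by
    rw [DFinsupp.mem_support_toFun]
    exact fun h' => h (by rw [h']; rfl)
  have := Finset.le_sup (f := id) this
  simp only [id] at this
  omega

theorem isHomogeneous_colon {I L : Ideal T} (hI : I.IsHomogeneous 𝒯) (hL : L.IsHomogeneous 𝒯) :
    (I.colon (L : Set T)).IsHomogeneous 𝒯 := by
  classical
  intro i r hr
  refine Submodule.mem_colon.2 fun s hs => ?_
  rw [← sum_support_decompose 𝒯 s, Finset.smul_sum]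
  refine sum_mem fun j _ => ?_
  have := hI (i + j) (Submodule.mem_colon.1 hr _ (hL j hs))
  rwa [smul_eq_mul, coe_decompose_mul_add_of_right_mem 𝒯 (SetLike.coe_mem _)] at this

/-- Prime ideals of the form `H : a` with `H` homogeneous are homogeneous. -/
theorem isHomogeneous_of_forall_mem_iff {H P : Ideal T} (hH : H.IsHomogeneous 𝒯) (hP : P.IsPrime)
    {a : T} (ha : ∀ t, t ∈ P ↔ t * a ∈ H) : P.IsHomogeneous 𝒯 := by
  obtain ⟨M, hM⟩ := exists_forall_decompose_eq_zero (𝒯 := 𝒯) a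
  have top : ∀ (N : ℕ) (x : T), x ∈ P → (∀ i > N, (decompose 𝒯 x i : T) = 0) →
      (decompose 𝒯 x N : T) ∈ P := by
    intro N x hx hN
    -- With `x_N` the top component, `x_N ^ j` multiplies `aᵢ` into `H` for all `i ≥ M - j`: in
    -- degree `N + i` of `x * a`, every other nonzero term involves some `a_k` with `k > i`. At `j =
    -- M` all of `a` is reached.
    have key : ∀ j i, M ≤ i + j → (decompose 𝒯 x N : T) ^ j * (decompose 𝒯 a i : T) ∈ H := by
      intro j
      induction j with
      | zero => intro i hi; rw [hM i hi]; simp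
      | succ j ih =>
        intro i hi
        have hmem : (decompose 𝒯 x N : T) ^ j * (decompose 𝒯 (x * a) (N + i) : T) ∈ H :=
          H.mul_mem_left _ (hH _ ((ha x).1 hx))
        rw [decompose_mul_eq_sum, ← Finset.add_sum_erase _ _
          (show (N, i) ∈ Finset.HasAntidiagonal.antidiagonal (N + i) by simp), mul_add, ← mul_assoc,
          ← pow_succ] at hmem
        refine (H.add_mem_iff_left ?_).1 hmem
        rw [Finset.mul_sum]
        refine sum_mem fun p hp => ?_
        obtain ⟨hne, hp⟩ := Finset.mem_erase.1 hp
        rw [Finset.HasAntidiagonal.mem_antidiagonal] at hp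
        rcases lt_trichotomy p.1 N with h | h | h
        · rw [mul_left_comm]
          exact H.mul_mem_left _ (ih _ (by omega))
        · exact absurd (Prod.ext h (by simp; omega)) hne
        · rw [hN _ h]; simp
    refine hP.mem_of_pow_mem M ((ha _).2 ?_)
    classical
    rw [← sum_support_decompose 𝒯 a, Finset.mul_sum]
    exact sum_mem fun i _ => key M i (by omega)
  have all : ∀ (N : ℕ) (x : T), x ∈ P → (∀ i ≥ N, (decompose 𝒯 x i : T) = 0) →
      ∀ i, (decompose 𝒯 x i : T) ∈ P := by
    intro N
    induction N with
    | zero => intro x _ h i; rw [h i (Nat.zero_le _)]; exact P.zero_mem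
    | succ N ih =>
      intro x hx h i
      have hxN := top N x hx fun i hi => h i hi
      have hdec : ∀ i, (decompose 𝒯 (x - (decompose 𝒯 x N : T)) i : T) =
          if i = N then 0 else (decompose 𝒯 x i : T) := by
        intro i
        rw [decompose_sub, DirectSum.sub_apply, AddSubgroupClass.coe_sub]
        split_ifs with hi
        · subst hi
          rw [decompose_of_mem_same 𝒯 (SetLike.coe_mem _), sub_self]
        · rw [decompose_of_mem_ne 𝒯 (SetLike.coe_mem _) (Ne.symm hi), sub_zero]
      by_cases hi : i = N
      · rw [hi]; exact hxN
      · have := ih _ (sub_mem hx hxN) (fun i hi => by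
          rw [hdec]
          split_ifs with h'
          · rfl
          · exact h i (by omega)) i
        rwa [hdec, if_neg hi] at this
  intro i x hx
  obtain ⟨N, hN⟩ := exists_forall_decompose_eq_zero (𝒯 := 𝒯) x
  exact all N x hx hN i

section Noetherian

variable [IsNoetherianRing T] (h0 : 𝒯 0 = 1) {H : Ideal T} (hH : H.IsHomogeneous 𝒯)

include h0 hH

theorem le_irrelevant_of_mem_associatedPrimes {P : Ideal T}
    (hP : P ∈ associatedPrimes T (T ⧸ H)) : P ≤ (HomogeneousIdeal.irrelevant 𝒯).toIdeal := by
  obtain ⟨a, ha⟩ := exists_forall_mem_iff_of_mem_associatedPrimes hP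
  exact le_irrelevant h0 (isHomogeneous_of_forall_mem_iff hH hP.isPrime ha) hP.isPrime.ne_top

theorem not_isMaximal_of_socleRankLE_zero
    (hs : SocleRankLE (HomogeneousIdeal.irrelevant 𝒯).toIdeal 0 H) (P : Ideal T)
    (hP : P ∈ associatedPrimes T (T ⧸ H)) : ¬ P.IsMaximal := by
  intro hmax
  have : Nontrivial T := ⟨⟨0, 1, fun h => hP.isPrime.ne_top
    ((Ideal.eq_top_iff_one _).2 (h ▸ P.zero_mem))⟩⟩
  have := hmax.eq_of_le (isMaximal_irrelevant h0).ne_top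
    (le_irrelevant_of_mem_associatedPrimes h0 hH hP)
  exact hs.notMem_associatedPrimes (this ▸ hP)

/-- The zerodivisors modulo `H` form the union of the associated primes, all inside the irrelevant
ideal. This is what undoes the localization. -/
theorem regularModulo_of_notMem_irrelevant {s : T}
    (hs : s ∉ (HomogeneousIdeal.irrelevant 𝒯).toIdeal) : RegularModulo H s := by
  rw [regularModulo_iff_isSMulRegular]
  by_contra h
  have : s ∈ ({r : T | IsSMulRegular (T ⧸ H) r}ᶜ : Set T) := h
  rw [← biUnion_associatedPrimes_eq_compl_regular] at this
  obtain ⟨P, hP, hsP⟩ := Set.mem_iUnion₂.1 this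
  exact hs (le_irrelevant_of_mem_associatedPrimes h0 hH hP hsP)

end Noetherian

/-- If `m` kills `a` modulo `0 : H`, it kills every `a * y` with `y ∈ H`, and each such product is
then zero. -/
theorem SocleRankLE.bot_colon {m H : Ideal T} (h : SocleRankLE m 0 (⊥ : Ideal T)) :
    SocleRankLE m 0 ((⊥ : Ideal T).colon (H : Set T)) := by
  rw [socleRankLE_zero_iff] at h ⊢
  intro a ha
  refine Submodule.mem_colon.2 fun y hy => h _ fun t ht => ?_
  have := Submodule.mem_colon.1 (ha t ht) y hy
  rwa [smul_eq_mul, mul_assoc] at this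

theorem isHomogeneous_pow {I : Ideal T} (hI : I.IsHomogeneous 𝒯) (n : ℕ) :
    (I ^ n).IsHomogeneous 𝒯 := by
  induction n with
  | zero => rw [pow_zero, Ideal.one_eq_top]; exact Ideal.IsHomogeneous.top 𝒯
  | succ n ih => rw [pow_succ]; exact ih.mul hI

end Graded

/-! ### Saturation -/

section Saturation

variable {𝕜 S : Type*} [Field 𝕜] [CommRing S] [Algebra 𝕜 S] (𝒜 : ℕ → Submodule 𝕜 S)
  [GradedAlgebra 𝒜]

theorem isHomogeneous_saturation {I : Ideal S} (hI : I.IsHomogeneous 𝒜) :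
    (saturation 𝒜 I).IsHomogeneous 𝒜 :=
  Ideal.IsHomogeneous.iSup fun _ => isHomogeneous_colon hI
    (isHomogeneous_pow (HomogeneousIdeal.isHomogeneous _) _)

theorem le_saturation (I : Ideal S) : I ≤ saturation 𝒜 I :=
  le_trans Ideal.le_colon (le_iSup (fun i : ℕ =>
    I.colon (((HomogeneousIdeal.irrelevant 𝒜).toIdeal ^ i : Ideal S) : Set S)) 0)

theorem mem_saturation_iff {I : Ideal S} {a : S} :
    a ∈ saturation 𝒜 I ↔
      ∃ i : ℕ, a ∈ I.colon (((HomogeneousIdeal.irrelevant 𝒜).toIdeal ^ i : Ideal S) : Set S) :=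
  Submodule.mem_iSup_of_directed _ (Monotone.directed_le fun _ _ hij =>
    Submodule.colon_mono le_rfl (SetLike.coe_subset_coe.2 (Ideal.pow_le_pow_right hij)))

/-- The irrelevant ideal is finitely generated, so one exponent works for all its generators; one
more power then absorbs `a` itself. -/
theorem socleRankLE_zero_saturation [IsNoetherianRing S] (I : Ideal S) :
    SocleRankLE (HomogeneousIdeal.irrelevant 𝒜).toIdeal 0 (saturation 𝒜 I) := by
  rw [socleRankLE_zero_iff]
  intro a ha
  obtain ⟨g, hg⟩ := IsNoetherian.noetherian (HomogeneousIdeal.irrelevant 𝒜).toIdeal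
  have hex : ∀ t ∈ g, ∃ i : ℕ, t * a ∈
      I.colon (((HomogeneousIdeal.irrelevant 𝒜).toIdeal ^ i : Ideal S) : Set S) := fun t ht =>
    (mem_saturation_iff 𝒜).1 (ha t (hg ▸ Ideal.subset_span ht))
  choose! e he using hex
  refine (mem_saturation_iff 𝒜).2 ⟨g.sup e + 1, ?_⟩
  rw [pow_succ']
  have hle : (HomogeneousIdeal.irrelevant 𝒜).toIdeal * (HomogeneousIdeal.irrelevant 𝒜).toIdeal ^
      g.sup e ≤ I.colon {a} := by
    refine Ideal.mul_le.2 fun t ht y hy => ?_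
    have : (HomogeneousIdeal.irrelevant 𝒜).toIdeal ≤ I.colon {y * a} := by
      rw [← hg]
      refine Ideal.span_le.2 fun t ht => Submodule.mem_colon_singleton.2 ?_
      have := Submodule.mem_colon.1 (he t ht) y
        (Ideal.pow_le_pow_right (Finset.le_sup (f := e) ht) hy)
      rwa [smul_eq_mul, mul_right_comm, mul_assoc] at this
    refine Submodule.mem_colon_singleton.2 ?_
    rw [smul_eq_mul, mul_assoc]
    exact Submodule.mem_colon_singleton.1 (this ht)
  refine Submodule.mem_colon.2 fun y hy => ?_
  have := Submodule.mem_colon_singleton.1 (hle hy)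
  rwa [smul_eq_mul, mul_comm] at this

end Saturation

/-! ### Passage to graded quotients -/

section Quotient

variable {𝕜 S : Type*} [Field 𝕜] [CommRing S] [Algebra 𝕜 S] (𝒜 : ℕ → Submodule 𝕜 S)
  [GradedAlgebra 𝒜]

theorem decompose_mk (J : HomogeneousIdeal 𝒜) (x : S) (i : ℕ) :
    (decompose (quotientGrading 𝒜 J.toIdeal) (Ideal.Quotient.mk J.toIdeal x) i : S ⧸ J.toIdeal) =
      Ideal.Quotient.mk J.toIdeal (decompose 𝒜 x i) :=
  rfl

theorem quotientGrading_zero (J : HomogeneousIdeal 𝒜) (h0 : 𝒜 0 = 1) :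
    quotientGrading 𝒜 J.toIdeal 0 = 1 := by
  rw [quotientGrading, h0]
  exact Submodule.map_one _

theorem mk_mem_irrelevant (J : HomogeneousIdeal 𝒜) {x : S}
    (hx : x ∈ (HomogeneousIdeal.irrelevant 𝒜).toIdeal) :
    Ideal.Quotient.mk J.toIdeal x ∈
      (HomogeneousIdeal.irrelevant (quotientGrading 𝒜 J.toIdeal)).toIdeal := by
  rw [mem_irrelevant_iff_decompose] at hx ⊢
  rw [decompose_mk, hx, map_zero]

theorem isHomogeneous_map_mk (J : HomogeneousIdeal 𝒜) {h : Ideal S} (hh : h.IsHomogeneous 𝒜) :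
    (h.map (Ideal.Quotient.mk J.toIdeal)).IsHomogeneous (quotientGrading 𝒜 J.toIdeal) := by
  intro i y hy
  obtain ⟨x, hx, rfl⟩ := (Ideal.mem_map_iff_of_surjective _ Ideal.Quotient.mk_surjective).1 hy
  rw [decompose_mk]
  exact Ideal.mem_map_of_mem _ (hh i hx)

theorem mk_mem_map_mk_iff {J h : Ideal S} (hJh : J ≤ h) {x : S} :
    Ideal.Quotient.mk J x ∈ h.map (Ideal.Quotient.mk J) ↔ x ∈ h := by
  rw [← Ideal.mem_comap, Ideal.comap_map_of_surjective' _ Ideal.Quotient.mk_surjective,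
    Ideal.mk_ker, sup_eq_left.2 hJh]

theorem SocleRankLE.map_mk (J : HomogeneousIdeal 𝒜) {h : Ideal S} (hJh : J.toIdeal ≤ h)
    (hs : SocleRankLE (HomogeneousIdeal.irrelevant 𝒜).toIdeal 0 h) :
    SocleRankLE (HomogeneousIdeal.irrelevant (quotientGrading 𝒜 J.toIdeal)).toIdeal 0
      (h.map (Ideal.Quotient.mk J.toIdeal)) := by
  rw [socleRankLE_zero_iff] at hs ⊢
  intro a ha
  obtain ⟨a, rfl⟩ := Ideal.Quotient.mk_surjective a
  refine Ideal.mem_map_of_mem _ (hs a fun t ht => ?_)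
  rw [← mk_mem_map_mk_iff hJh, map_mul]
  exact ha _ (mk_mem_irrelevant 𝒜 J ht)

/-- If `1` were in the saturation, a power of the irrelevant ideal would lie in `I`, and every point
of Proj would contain the irrelevant ideal. -/
theorem ne_top_of_nonempty_projectiveSpectrum (I : HomogeneousIdeal 𝒜)
    (hne : Nonempty (ProjectiveSpectrum (quotientGrading 𝒜 I.toIdeal))) :
    saturation 𝒜 I.toIdeal ≠ ⊤ := by
  obtain ⟨P⟩ := hne
  intro htop
  have hPp := P.isPrime
  have hmem : (1 : S) ∈ saturation 𝒜 I.toIdeal := htop ▸ trivial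
  obtain ⟨i, hi⟩ := (mem_saturation_iff 𝒜).1 hmem
  refine P.not_irrelevant_le fun y hy => ?_
  have hsub : (HomogeneousIdeal.irrelevant 𝒜).toIdeal ^ i ≤
      P.asHomogeneousIdeal.toIdeal.comap (Ideal.Quotient.mk I.toIdeal) := by
    intro x hx
    have := Submodule.mem_colon.1 hi x hx
    rw [smul_eq_mul, one_mul] at this
    rw [Ideal.mem_comap, Ideal.Quotient.eq_zero_iff_mem.2 this]
    exact zero_mem _
  have hle := Ideal.IsPrime.le_of_pow_le hsub
  obtain ⟨x, rfl⟩ := Ideal.Quotient.mk_surjective y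
  have hx0 : Ideal.Quotient.mk I.toIdeal (decompose 𝒜 x 0 : S) = 0 := hy
  have hx : x - (decompose 𝒜 x 0 : S) ∈ (HomogeneousIdeal.irrelevant 𝒜).toIdeal := by
    rw [mem_irrelevant_iff_decompose, decompose_sub, decompose_coe]
    simp
  have := hle hx
  rwa [Ideal.mem_comap, map_sub, hx0, sub_zero] at this

end Quotient

/-! ### Annihilators as graded Hom modules -/

section GradedIso

variable {𝕜 T : Type*} [Field 𝕜] [CommRing T] [Algebra 𝕜 T] {𝒯 : ℕ → Submodule 𝕜 T}
  [GradedAlgebra 𝒯]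

/-- A map out of `T ⧸ H` is determined by the image of `1`, which can be any element killed by `H`.
Degrees agree because `1` has degree zero. -/
theorem gradedIsoHomQuotient_of_eq_colon {H K : Ideal T}
    (hK : K = (⊥ : Ideal T).colon (H : Set T)) : GradedIsoHomQuotient 𝒯 K H := by
  have hmul : ∀ x ∈ K, ∀ y ∈ H, x * y = 0 := fun x hx y hy => by
    rw [hK] at hx
    simpa using Submodule.mem_colon.1 hx y hy
  let toHom : K →ₗ[T] ((T ⧸ H) →ₗ[T] T) :=
    { toFun := fun x => H.liftQ (LinearMap.toSpanSingleton T T (x : T)) fun y hy => by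
        simpa [mul_comm] using hmul x x.2 y hy
      map_add' := fun x y => Submodule.linearMap_qext _ (LinearMap.ext_ring
        (show (1 : T) * ((x : T) + y) = 1 * x + 1 * y by ring))
      map_smul' := fun c x => Submodule.linearMap_qext _ (LinearMap.ext_ring
        (show (1 : T) * (c * (x : T)) = c * (1 * x) by ring)) }
  have htoHom : ∀ (x : K) (t : T), toHom x (Ideal.Quotient.mk H t) = t * (x : T) := fun x t => rfl
  have hbij : Function.Bijective toHom := by
    constructor
    · intro x y hxy
      have := LinearMap.congr_fun hxy (Ideal.Quotient.mk H 1)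
      rw [htoHom, htoHom, one_mul, one_mul] at this
      exact Subtype.ext this
    · intro φ
      have hφ : ∀ t, φ (Ideal.Quotient.mk H t) = t * φ (Ideal.Quotient.mk H 1) := fun t => by
        rw [← smul_eq_mul t, ← map_smul]
        congr 1
        change _ = Ideal.Quotient.mk H (t * 1)
        rw [mul_one]
      refine ⟨⟨φ (Ideal.Quotient.mk H 1), ?_⟩, ?_⟩
      · rw [hK]
        refine Submodule.mem_colon.2 fun y hy => ?_
        rw [smul_eq_mul, mul_comm, ← hφ, Ideal.Quotient.eq_zero_iff_mem.2 hy, map_zero]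
        exact zero_mem _
      · refine LinearMap.ext fun y => ?_
        obtain ⟨t, rfl⟩ := Ideal.Quotient.mk_surjective y
        exact (htoHom _ t).trans (hφ t).symm
  refine ⟨LinearEquiv.ofBijective toHom hbij, fun d x => ⟨fun hx i y hy => ?_, fun hx => ?_⟩⟩
  · obtain ⟨t, ht, rfl⟩ := hy
    change toHom x (Ideal.Quotient.mk H t) ∈ _
    rw [htoHom]
    unfold intGrading at hx ⊢
    split_ifs at hx with hd
    · rw [if_pos (by omega)]
      have := SetLike.mul_mem_graded (A := 𝒯) ht hx
      rwa [show i + d.toNat = ((i : ℤ) + d).toNat by omega] at this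
    · rw [(Submodule.mem_bot 𝕜).1 hx, mul_zero]
      exact zero_mem _
  · have := hx 0 (Ideal.Quotient.mk H 1) (mk_mem_quotientGrading 𝒯 H SetLike.GradedOne.one_mem)
    change toHom x (Ideal.Quotient.mk H 1) ∈ _ at this
    rwa [htoHom, one_mul, Nat.cast_zero, zero_add] at this

end GradedIso

end GradedLinkage

end

noncomputable section

namespace GradedLinkage

open DirectSum

theorem ofList_ofFn {R : Type*} [CommRing R] {n : ℕ} (g : Fin n → R) :
    Ideal.ofList (List.ofFn g) = Ideal.span (Set.range g) := by
  rw [Ideal.ofList]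
  congr 1
  ext p
  exact List.mem_ofFn' g p

/-! ### The polynomial ring -/

section Polynomial

open MvPolynomial

variable {𝕜 : Type*} [Field 𝕜]

theorem irrelevant_eq_ofList (n : ℕ) :
    (HomogeneousIdeal.irrelevant (homogeneousSubmodule (Fin n) 𝕜)).toIdeal =
      Ideal.ofList (List.ofFn (X : Fin n → MvPolynomial (Fin n) 𝕜)) := by
  have hspan : Ideal.ofList (List.ofFn (X : Fin n → MvPolynomial (Fin n) 𝕜)) =
      Ideal.span (X '' Set.univ) := by
    rw [ofList_ofFn, Set.image_univ]
  rw [hspan]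
  refine le_antisymm (fun p hp => ?_) (Ideal.span_le.2 ?_)
  · have hp0 : homogeneousComponent 0 p = 0 := by
      rw [← decomposition.decompose'_apply]
      exact hp
    rw [homogeneousComponent_zero, C_eq_zero] at hp0
    rw [mem_ideal_span_X_image]
    intro e he
    have hne : e ≠ 0 := fun h => mem_support_iff.1 he (h ▸ hp0)
    obtain ⟨i, hi⟩ := Finsupp.ne_iff.1 hne
    exact ⟨i, trivial, hi⟩
  · rintro _ ⟨i, -, rfl⟩
    exact HomogeneousIdeal.mem_irrelevant_of_mem _ one_pos (isHomogeneous_X 𝕜 i)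

theorem isCompleteIntersection_quotientGrading {n m : ℕ} {g : Fin m → MvPolynomial (Fin n) 𝕜}
    {d : Fin m → ℕ} (hg : ∀ i, (g i).IsHomogeneous (d i))
    (hreg : RingTheory.Sequence.IsRegular (MvPolynomial (Fin n) 𝕜) (List.ofFn g))
    {J : Ideal (MvPolynomial (Fin n) 𝕜)} (hJ : J = Ideal.span (Set.range g)) :
    IsCompleteIntersection (quotientGrading (homogeneousSubmodule (Fin n) 𝕜) J) := by
  subst hJ
  exact ⟨n, m, g, d, hg, hreg, AlgEquiv.refl, fun i x => Iff.rfl⟩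

end Polynomial

end GradedLinkage

end

/-! ### The linkage theorem -/

open GradedLinkage in
theorem theorem4p3 {𝕜 : Type*} [Field 𝕜] [IsAlgClosed 𝕜] (n : ℕ)
    (f : Fin (n + 1) → MvPolynomial (Fin (n + 1)) 𝕜) (d : Fin (n + 1) → ℕ)
    (hf : ∀ i, (f i).IsHomogeneous (d i))
    (hreg : RingTheory.Sequence.IsRegular (MvPolynomial (Fin (n + 1)) 𝕜)
      (List.ofFn fun i : Fin n => f i.succ))
    (I J : HomogeneousIdeal (MvPolynomial.homogeneousSubmodule (Fin (n + 1)) 𝕜))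
    (hI : I.toIdeal = Ideal.span (Set.range f))
    (hJ : J.toIdeal = Ideal.span (Set.range fun i : Fin n => f i.succ))
    (hdim : topologicalKrullDim (ProjectiveSpectrum
      (quotientGrading (MvPolynomial.homogeneousSubmodule (Fin (n + 1)) 𝕜) I.toIdeal)) = 0)
    (H K : Ideal (MvPolynomial (Fin (n + 1)) 𝕜 ⧸ J.toIdeal))
    (hH : H = (saturation (MvPolynomial.homogeneousSubmodule (Fin (n + 1)) 𝕜) I.toIdeal).map
      (Ideal.Quotient.mk J.toIdeal))
    (hK : K = (⊥ : Ideal (MvPolynomial (Fin (n + 1)) 𝕜 ⧸ J.toIdeal)).colon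
      (H : Set (MvPolynomial (Fin (n + 1)) 𝕜 ⧸ J.toIdeal))) :
    GradedIsoHomQuotient
      (quotientGrading (MvPolynomial.homogeneousSubmodule (Fin (n + 1)) 𝕜) J.toIdeal) K H ∧
    GradedIsoHomQuotient
      (quotientGrading (MvPolynomial.homogeneousSubmodule (Fin (n + 1)) 𝕜) J.toIdeal) H K ∧
    (IsCohenMacaulayRing ((MvPolynomial (Fin (n + 1)) 𝕜 ⧸ J.toIdeal) ⧸ H) ∧
      ringKrullDim ((MvPolynomial (Fin (n + 1)) 𝕜 ⧸ J.toIdeal) ⧸ H) = 1) ∧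
    (I ≠ J →
      AlgebraicallyLinked
        (quotientGrading (MvPolynomial.homogeneousSubmodule (Fin (n + 1)) 𝕜) J.toIdeal) H K ∧
      IsCohenMacaulayRing ((MvPolynomial (Fin (n + 1)) 𝕜 ⧸ J.toIdeal) ⧸ K) ∧
      ringKrullDim ((MvPolynomial (Fin (n + 1)) 𝕜 ⧸ J.toIdeal) ⧸ K) = 1) := by
  let S := MvPolynomial (Fin (n + 1)) 𝕜
  let 𝒮 := MvPolynomial.homogeneousSubmodule (Fin (n + 1)) 𝕜
  let fs : List S := List.ofFn fun i : Fin n => f i.succ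
  let m : Ideal S := (HomogeneousIdeal.irrelevant 𝒮).toIdeal
  let Is : Ideal S := saturation 𝒮 I.toIdeal
  have h0 : 𝒮 0 = 1 := MvPolynomial.homogeneousSubmodule_zero _
  have hmax : m.IsMaximal := isMaximal_irrelevant h0
  have hJfs : J.toIdeal = Ideal.ofList fs := hJ.trans (ofList_ofFn _).symm
  have hJI : J.toIdeal ≤ I.toIdeal := by
    rw [hI, hJ]
    exact Ideal.span_mono (by rintro _ ⟨i, rfl⟩; exact ⟨i.succ, rfl⟩)
  have hJIs : J.toIdeal ≤ Is := hJI.trans (le_saturation 𝒮 _)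
  have hJtop : J.toIdeal ≠ ⊤ := by
    intro h
    refine hreg.top_ne_smul ?_
    change _ = Ideal.ofList fs • _
    rw [← hJfs, h]
    simp
  have hJm : J.toIdeal ≤ m := le_irrelevant h0 J.isHomogeneous hJtop
  have hfm : ∀ g ∈ fs, g ∈ m := fun g hg => hJm (hJfs ▸ Ideal.subset_span hg)
  have hfreg : RegularSeqModulo ⊥ fs := RegularSeqModulo.of_isWeaklyRegular hreg.toIsWeaklyRegular
  have hIs : Is.IsHomogeneous 𝒮 := isHomogeneous_saturation 𝒮 I.isHomogeneous
  have hIstop : Is ≠ ⊤ := by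
    refine ne_top_of_nonempty_projectiveSpectrum 𝒮 I (not_isEmpty_iff.1 fun hempty => ?_)
    have : IsEmpty (TopologicalSpace.IrreducibleCloseds
        (ProjectiveSpectrum (quotientGrading 𝒮 I.toIdeal))) :=
      ⟨fun Z => hempty.elim Z.isIrreducible.nonempty.some⟩
    rw [topologicalKrullDim, Order.krullDim_eq_bot] at hdim
    exact WithBot.bot_ne_coe hdim
  have hsIs : SocleRankLE m 0 Is := socleRankLE_zero_saturation 𝒮 I.toIdeal
  -- the variables form a regular sequence generating the irrelevant ideal
  let xs : List S := List.ofFn fun i : Fin n => MvPolynomial.X i.castSucc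
  have hvars : List.ofFn (MvPolynomial.X : Fin (n + 1) → S) =
      xs ++ [MvPolynomial.X (Fin.last n)] := by
    rw [List.ofFn_succ', List.concat_eq_append]
  have hxs : m = Ideal.ofList (xs ++ [MvPolynomial.X (Fin.last n)]) := by
    rw [← hvars]; exact irrelevant_eq_ofList (n + 1)
  have hx : RegularSeqModulo ⊥ (xs ++ [MvPolynomial.X (Fin.last n)]) := by
    rw [← hvars]; exact regularSeqModulo_variables 𝕜 (n + 1)
  have hlen : fs.length = xs.length := by simp [fs, xs]
  have hsJ : SocleRankLE m 0 J.toIdeal := by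
    rw [hJfs]; exact socleRankLE_zero_ofList hxs hx hlen hfm hfreg
  -- the quotient `T = S ⧸ J`
  let 𝒯 := quotientGrading 𝒮 J.toIdeal
  have h0T : 𝒯 0 = 1 := quotientGrading_zero 𝒮 J h0
  have hHhom : H.IsHomogeneous 𝒯 := hH ▸ isHomogeneous_map_mk 𝒮 J hIs
  have hKhom : K.IsHomogeneous 𝒯 := hK ▸ isHomogeneous_colon (Ideal.IsHomogeneous.bot 𝒯) hHhom
  have hsbot : SocleRankLE (HomogeneousIdeal.irrelevant 𝒯).toIdeal 0
      (⊥ : Ideal (S ⧸ J.toIdeal)) := by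
    have := hsJ.map_mk 𝒮 J le_rfl
    rwa [Ideal.map_quotient_self] at this
  have hsH : SocleRankLE (HomogeneousIdeal.irrelevant 𝒯).toIdeal 0 H :=
    hH ▸ hsIs.map_mk 𝒮 J hJIs
  have hsK : SocleRankLE (HomogeneousIdeal.irrelevant 𝒯).toIdeal 0 K := hK ▸ hsbot.bot_colon
  have hHass := not_isMaximal_of_socleRankLE_zero h0T hHhom hsH
  have hKass := not_isMaximal_of_socleRankLE_zero h0T hKhom hsK
  have hdimT : ringKrullDim (S ⧸ J.toIdeal) ≤ 1 := by
    have h1 := (ringKrullDim_quotient_sup_add_length_le hfreg).trans (ringKrullDim_quotient_le _)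
    rw [bot_sup_eq, ← hJfs, MvPolynomial.ringKrullDim_of_isNoetherianRing,
      ringKrullDim_eq_zero_of_field] at h1
    have h2 : fs.length = n := by simp [fs]
    rw [h2, zero_add, Nat.card_fin] at h1
    generalize ringKrullDim (S ⧸ J.toIdeal) = D at h1
    induction D with
    | bot => exact bot_le
    | coe D =>
      have h3 : D + (n : ℕ∞) ≤ 1 + n := by rw [add_comm 1]; exact_mod_cast h1
      exact_mod_cast (ENat.add_le_add_iff_right (ENat.natCast_ne_top n)).1 h3
  have hdimH := (ringKrullDim_quotient_le H).trans hdimT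
  have hdimK := (ringKrullDim_quotient_le K).trans hdimT
  have hHass' := not_isMaximal_of_mem_associatedPrimes_quotient hHass
  have hKass' := not_isMaximal_of_mem_associatedPrimes_quotient hKass
  have hHtop : H ≠ ⊤ := by
    intro h
    refine hIstop ((Ideal.eq_top_iff_one _).2 ((mk_mem_map_mk_iff hJIs).1 ?_))
    rw [← hH, h]
    trivial
  have hHnt := Ideal.Quotient.nontrivial_iff.2 hHtop
  -- the double annihilator property
  have hHK : H = (⊥ : Ideal (S ⧸ J.toIdeal)).colon (K : Set (S ⧸ J.toIdeal)) := by
    refine le_antisymm (fun y hy => Submodule.mem_colon.2 fun c hc => ?_) fun y hy => ?_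
    · rw [hK] at hc
      simpa [mul_comm] using Submodule.mem_colon.1 hc y hy
    · obtain ⟨a, rfl⟩ := Ideal.Quotient.mk_surjective y
      have ha : a ∈ (Ideal.ofList fs).colon
          (((Ideal.ofList fs).colon (Is : Set S) : Ideal S) : Set S) := by
        rw [← hJfs]
        refine Submodule.mem_colon.2 fun c hc => ?_
        have hcK : Ideal.Quotient.mk J.toIdeal c ∈ K := by
          rw [hK]
          refine Submodule.mem_colon.2 fun z hz => ?_
          rw [hH] at hz
          obtain ⟨b, hb, rfl⟩ :=
            (Ideal.mem_map_iff_of_surjective _ Ideal.Quotient.mk_surjective).1 hz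
          exact Ideal.Quotient.eq_zero_iff_mem.2 (Submodule.mem_colon.1 hc b hb)
        exact Ideal.Quotient.eq_zero_iff_mem.1 (Submodule.mem_colon.1 hy _ hcK)
      -- The local result leaves a multiplier `s` outside `S₊`, which is cancelled because `Is` is
      -- homogeneous.
      obtain ⟨s, hs, hsa⟩ := exists_mul_mem_of_mem_colon_colon hxs hx hlen hfm hfreg
        (hJfs ▸ hJIs) hsIs ha
      rw [hH]
      exact Ideal.mem_map_of_mem _ (regularModulo_of_notMem_irrelevant h0 hIs hs a hsa)
  have hisoK : GradedIsoHomQuotient 𝒯 K H := gradedIsoHomQuotient_of_eq_colon hK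
  have hisoH : GradedIsoHomQuotient 𝒯 H K := gradedIsoHomQuotient_of_eq_colon hHK
  refine ⟨hisoK, hisoH, ⟨isCohenMacaulayRing_of_forall_not_isMaximal hdimH hHass',
    ringKrullDim_eq_one (Q := (S ⧸ J.toIdeal) ⧸ H) hdimH hHass'⟩, fun hIJ => ?_⟩
  -- If `1 ∈ K`, then `H = 0`, which forces `I ≤ J`.
  have hKtop : K ≠ ⊤ := by
    intro h
    refine hIJ (HomogeneousIdeal.toIdeal_injective (le_antisymm (fun a ha => ?_) hJI))
    have h1 : (1 : S ⧸ J.toIdeal) ∈ K := h ▸ trivial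
    rw [hK] at h1
    have haH : Ideal.Quotient.mk J.toIdeal a ∈ H :=
      hH ▸ Ideal.mem_map_of_mem _ (le_saturation 𝒮 _ ha)
    have := Submodule.mem_colon.1 h1 _ haH
    rw [one_smul] at this
    exact Ideal.Quotient.eq_zero_iff_mem.1 this
  have hKnt := Ideal.Quotient.nontrivial_iff.2 hKtop
  exact ⟨{
    completeIntersection := isCompleteIntersection_quotientGrading (fun i => hf i.succ) hreg hJ
    homogeneous_left := hHhom
    homogeneous_right := hKhom
    height_left := height_eq_zero_of_forall_not_isMaximal hdimT hHtop hHass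
    height_right := height_eq_zero_of_forall_not_isMaximal hdimT hKtop hKass
    equidimensional_left := isEquidimensional_of_forall_not_isMaximal hdimH hHass'
    equidimensional_right := isEquidimensional_of_forall_not_isMaximal hdimK hKass'
    noEmbedded_left := hasNoEmbeddedComponents_of_forall_not_isMaximal hdimH hHass'
    noEmbedded_right := hasNoEmbeddedComponents_of_forall_not_isMaximal hdimK hKass'
    iso_left := hisoH
    iso_right := hisoK },
    isCohenMacaulayRing_of_forall_not_isMaximal hdimK hKass',
    ringKrullDim_eq_one (Q := (S ⧸ J.toIdeal) ⧸ K) hdimK hKass'⟩
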